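/- Let $p$ be a prime and let $|\cdot|_p$ be the absolute value on $\mathbb{Q}_p$ with $|p|_p=p^{-1}$. For $P\in\mathbb{Z}[X]$ let $H(P)$ be the maximum of the absolute values of the coefficients of $P$; for an algebraic number $\alpha\in\mathbb{Q}_p$ let $H(\alpha)=H(P)$, where $P$ is the minimal polynomial of $\alpha$ over $\mathbb{Z}$ (irreducible and primitive). For $\xi\in\mathbb{Q}_p$ and $n\ge 1$, let $w_n(\xi)$ (resp. $w_n^*(\xi)$) be the supremum in $[-\infty,+\infty]$ of the real numbers $w$ (resp. $w^*$) such that $$0<|P(\xi)|_p\le H(P)^{-w-1}\qquad(\text{resp. } 0<|\xi-\alpha|_p\le H(\alpha)^{-w^*-1})$$ for infinitely many $P\in\mathbb{Z}[X]$ of degree at most $n$ (resp. algebraic numbers $\alpha\in\mathbb{Q}_p$ of degree at most $n$). **Theorem.** Let $d\ge 2$ be an integer, let $w\ge (3d+2+\sqrt{9d^2+4d+4})/2$ be a real number, let $b$ be a positive integer and let $(\varepsilon_i)_{i\ge 0}$ be a sequence in $\{0,1\}$. Let $(a_n)_{n\ge 1}$ be the sequence given by $$a_n=\begin{cases} b+3i+2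 & \text{if } n=\lfloor w^i\rfloor \text{ for some integer } i\ge 0,\\ b+3i+\varepsilon_i & \text{if } \lfloor w^i\rfloor<n<\lfloor w^{i+1}\rfloor \text{ for some integer } i\ge 0.\end{cases}$$ Let $b_0\in\{0,1,\dots,p-1\}$. Then Schneider's $p$-adic continued fraction $$b_0+\cfrac{p^{a_1}}{1+\cfrac{p^{a_2}}{1+\cfrac{p^{a_3}}{1+\cdots}}}$$ converges in $\mathbb{Q}_p$, and its value $\xi$ satisfies $$w_n^*(\xi)=w-1,\qquad w_n(\xi)=w\qquad\text{for all integers } n \text{ with } 2\le n\le d.$$ -/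

import Mathlib

open Polynomial Filter Topology

noncomputable section

/-- The minimal polynomial over `ℤ` of an algebraic number `α` in `ℚ_p`, that is, the primitive
integer polynomial proportional to the minimal polynomial of `α` over `ℚ`. It is determined up
to sign, which does not affect its height. -/
def intMinpoly {p : ℕ} [Fact p.Prime] (α : ℚ_[p]) : ℤ[X] :=
  (IsLocalization.integerNormalization (nonZeroDivisors ℤ) (minpoly ℚ α)).primPart

/-- The height `H(α)` of an algebraic number `α` in `ℚ_p`: the maximum of the absolute values of
the coefficients of its minimal polynomial over `ℤ`. (For `P : ℤ[X]`, the height `H(P)` is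
`P.supNorm`.) -/
def algHeight {p : ℕ} [Fact p.Prime] (α : ℚ_[p]) : ℝ :=
  (intMinpoly α).supNorm

/-- The exponent `w_n(ξ)` of a `p`-adic number `ξ`: the supremum, in the extended reals, of the
real numbers `w` such that `0 < |P(ξ)|_p ≤ H(P)^(-w-1)` for infinitely many integer polynomials
`P` of degree at most `n`. -/
def exponentW {p : ℕ} [Fact p.Prime] (n : ℕ) (ξ : ℚ_[p]) : EReal :=
  sSup {x : EReal | ∃ w : ℝ, x = (w : EReal) ∧
    {P : ℤ[X] | P.natDegree ≤ n ∧ 0 < ‖aeval ξ P‖ ∧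
      ‖aeval ξ P‖ ≤ P.supNorm ^ (-w - 1)}.Infinite}

/-- The exponent `w_n^*(ξ)` of a `p`-adic number `ξ`: the supremum, in the extended reals, of the
real numbers `w` such that `0 < |ξ - α|_p ≤ H(α)^(-w-1)` for infinitely many algebraic numbers
`α` in `ℚ_p` of degree at most `n`. -/
def exponentWStar {p : ℕ} [Fact p.Prime] (n : ℕ) (ξ : ℚ_[p]) : EReal :=
  sSup {x : EReal | ∃ w : ℝ, x = (w : EReal) ∧
    {α : ℚ_[p] | IsAlgebraic ℚ α ∧ (minpoly ℚ α).natDegree ≤ n ∧ 0 < ‖ξ - α‖ ∧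
      ‖ξ - α‖ ≤ algHeight α ^ (-w - 1)}.Infinite}

/-- Schneider's `p`-adic continued fraction
`b₀ + p^(a 1) / (1 + p^(a 2) / (1 + p^(a 3) / (1 + ⋯)))` as a formal continued fraction
over `ℚ_p`; the term `a 0` is not used. -/
def schneiderCF (p : ℕ) [Fact p.Prime] (b₀ : ℕ) (a : ℕ → ℕ) : GenContFract ℚ_[p] where
  h := (b₀ : ℚ_[p])
  s := Stream'.Seq.ofStream (fun k : ℕ => ⟨(p : ℚ_[p]) ^ a (k + 1), 1⟩)

/-- `ξ` is the value of Schneider's continued fraction with leading digit `b₀` and partial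
quotients `a 1, a 2, …`: its convergents tend to `ξ` in `ℚ_p`. -/
def IsSchneiderValue {p : ℕ} [Fact p.Prime] (b₀ : ℕ) (a : ℕ → ℕ) (ξ : ℚ_[p]) : Prop :=
  Tendsto (fun k : ℕ => (schneiderCF p b₀ a).convs k) atTop (𝓝 ξ)

end

noncomputable section

/-! The number `ξ` has unusually good quadratic approximations. Cut its expansion at the start of
block `j` and continue it with the constant partial quotient `c_j = b + 3j + ε_j` of that block:
this produces an integer quadratic `F_j`. Put `s_j = a_1 + ⋯ + a_⌊w^j⌋`. Then `H(F_j) ≤ p^(s_j +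
o(s_j))`, the discriminant is `(1 + 4 p^(c_j)) p^(2 s_j)`, and `|F_j(ξ)|_p = p^(-(s_j + s_(j+1)) +
O(1))` (`norm_quadForm`). The partial quotients tend to infinity, but only linearly in the block
index, so `⌊w^j⌋ = o(s_j)`, `c_j = o(s_j)` and `s_(j+1) / s_j → w`. Hence the exponent `w` is
attained along `F_j`. As `F_j'(ξ)` has size `p^(-s_j)`, Hensel's lemma gives a root at distance
about `p^(-w s_j)` from `ξ`, which accounts for `w - 1`.

For the upper bounds, let `P` be irreducible of degree at most `d`. If `P` divides no late `F_j`,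
the nonzero resultant of `P` and `F_j` prevents both from being small at `ξ`. Taking the first `j`
for which `F_j(ξ)` is negligible gives `|P(ξ)|_p ≫ H(P)^(-w)` (`exists_lower_bound_of_not_dvd`), and
this is where `w` must be large compared with `d`. If `P` divides a late `F_j`, the two are
proportional because the discriminant is not a square; the discriminant also forces `H(P)` to be
nearly `p^(s_j)`, so the exact size of `F_j(ξ)` bounds `|P(ξ)|_p` and the distance to the roots
(`eventually_lower_bound_of_dvd`). Multiplicativity of the Mahler measure extends the bound to
reducible polynomials, and finiteness of the polynomials of bounded degree and height bounds the
exponents. -/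

/-! ### Heights and Mahler measures of integer polynomials -/

lemma one_le_supNorm {P : ℤ[X]} (hP : P ≠ 0) : 1 ≤ P.supNorm := by
  have h : P.leadingCoeff ≠ 0 := leadingCoeff_ne_zero.mpr hP
  have h1 := P.le_supNorm P.natDegree
  have h2 : (1 : ℝ) ≤ ‖P.coeff P.natDegree‖ := by
    rw [Int.norm_eq_abs]; exact_mod_cast Int.one_le_abs h
  linarith

lemma supNorm_le_of_coeff_le {P : ℤ[X]} {B : ℝ} (h : ∀ i, |(P.coeff i : ℝ)| ≤ B) :
    P.supNorm ≤ B := by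
  obtain ⟨i, hi⟩ := P.exists_eq_supNorm
  rw [hi, Int.norm_eq_abs]; exact h i

lemma abs_coeff_le_supNorm (P : ℤ[X]) (i : ℕ) : |(P.coeff i : ℝ)| ≤ P.supNorm := by
  have := P.le_supNorm i
  rwa [Int.norm_eq_abs] at this

lemma supNorm_map_castRingHom (P : ℤ[X]) :
    (P.map (Int.castRingHom ℂ)).supNorm = P.supNorm := by
  rw [supNorm_eq_iSup, supNorm_eq_iSup]
  congr 1; ext i
  rw [coeff_map, eq_intCast, Complex.norm_intCast, Int.norm_eq_abs]

lemma mahlerMeasure_le_mul_supNorm {n : ℕ} {P : ℤ[X]} (hn : P.natDegree ≤ n) :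
    (P.map (Int.castRingHom ℂ)).mahlerMeasure ≤ (n + 1) * P.supNorm := by
  have h := (P.map (Int.castRingHom ℂ)).mahlerMeasure_le_sqrt_natDegree_add_one_mul_supNorm
  rw [supNorm_map_castRingHom, natDegree_map_eq_of_injective Int.cast_injective] at h
  refine h.trans ?_
  have := P.supNorm_nonneg
  gcongr
  have h0 : (P.natDegree : ℝ) ≤ n := by exact_mod_cast hn
  rw [Real.sqrt_le_left (by positivity)]
  nlinarith

lemma supNorm_le_two_pow_mul_mahlerMeasure {n : ℕ} {P : ℤ[X]} (hn : P.natDegree ≤ n) :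
    P.supNorm ≤ 2 ^ n * (P.map (Int.castRingHom ℂ)).mahlerMeasure := by
  have h := (P.map (Int.castRingHom ℂ)).supNorm_le_choose_natDegree_div_two_mul_mahlerMeasure
  rw [supNorm_map_castRingHom, natDegree_map_eq_of_injective Int.cast_injective] at h
  refine h.trans ?_
  have h0 := mahlerMeasure_nonneg (P.map (Int.castRingHom ℂ))
  gcongr
  have h1 : P.natDegree.choose (P.natDegree / 2) ≤ 2 ^ n :=
    (Nat.choose_le_two_pow _ _).trans (Nat.pow_le_pow_right (by norm_num) hn)
  exact_mod_cast h1

lemma finite_natDegree_le_supNorm_le (n : ℕ) (B : ℝ) :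
    {P : ℤ[X] | P.natDegree ≤ n ∧ P.supNorm ≤ B}.Finite := by
  refine (finite_mahlerMeasure_le n (Real.toNNReal ((n + 1) * B))).subset ?_
  rintro P ⟨h1, h2⟩
  refine ⟨h1, ?_⟩
  have := P.supNorm_nonneg.trans h2
  rw [Real.coe_toNNReal _ (by positivity)]
  refine (mahlerMeasure_le_mul_supNorm h1).trans ?_
  gcongr

/-! ### Integers and integer polynomials at `p`-adic integers -/

/-- The power of `p` dividing a nonzero integer is at most its absolute value. All Liouville-type
bounds below rest on this. -/
lemma one_div_abs_le_norm_intCast {p : ℕ} [Fact p.Prime] {z : ℤ} (hz : z ≠ 0) :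
    1 / |(z : ℝ)| ≤ ‖(z : ℚ_[p])‖ := by
  have hz' : (z : ℚ_[p]) ≠ 0 := by exact_mod_cast hz
  have hp : 0 < (p : ℝ) := by exact_mod_cast (Fact.out : p.Prime).pos
  have h := Padic.norm_eq_zpow_neg_valuation hz'
  rw [Padic.valuation_intCast] at h
  have h2 := (Padic.norm_int_le_pow_iff_dvd (p := p) z _).mp h.le
  have h3 : (p : ℤ) ^ padicValInt p z ≤ |z| := Int.le_of_dvd (abs_pos.mpr hz) ((dvd_abs _ _).mpr h2)
  have h4 : (p : ℝ) ^ padicValInt p z ≤ |(z : ℝ)| := by exact_mod_cast h3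
  rw [h, zpow_neg, zpow_natCast, one_div]
  gcongr

lemma aeval_coe_padicInt {p : ℕ} [Fact p.Prime] (x : ℤ_[p]) (P : ℤ[X]) :
    aeval (x : ℚ_[p]) P = ((P.map (Int.castRingHom ℤ_[p])).eval x : ℤ_[p]) := by
  have h := aeval_algebraMap_apply ℚ_[p] x P
  rw [eval_map, ← algebraMap_int_eq, ← aeval_def]
  exact h

lemma norm_aeval_le_one {p : ℕ} [Fact p.Prime] {ξ : ℚ_[p]} (hξ : ‖ξ‖ ≤ 1) (P : ℤ[X]) :
    ‖aeval ξ P‖ ≤ 1 := by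
  obtain ⟨x, rfl⟩ : ∃ x : ℤ_[p], (x : ℚ_[p]) = ξ := ⟨⟨ξ, hξ⟩, rfl⟩
  rw [aeval_coe_padicInt]
  exact PadicInt.norm_le_one _

lemma norm_aeval_sub_aeval_le {p : ℕ} [Fact p.Prime] {ξ α : ℚ_[p]} (hξ : ‖ξ‖ ≤ 1)
    (hα : ‖α‖ ≤ 1) (P : ℤ[X]) : ‖aeval ξ P - aeval α P‖ ≤ ‖ξ - α‖ := by
  obtain ⟨x, rfl⟩ : ∃ x : ℤ_[p], (x : ℚ_[p]) = ξ := ⟨⟨ξ, hξ⟩, rfl⟩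
  obtain ⟨y, rfl⟩ : ∃ y : ℤ_[p], (y : ℚ_[p]) = α := ⟨⟨α, hα⟩, rfl⟩
  rw [aeval_coe_padicInt, aeval_coe_padicInt]
  obtain ⟨c, hc⟩ := sub_dvd_eval_sub x y (P.map (Int.castRingHom ℤ_[p]))
  rw [← PadicInt.coe_sub, hc, PadicInt.coe_mul, norm_mul, PadicInt.coe_sub]
  exact mul_le_of_le_one_right (norm_nonneg _) (PadicInt.norm_le_one c)

/-! ### Resultants and lower bounds for polynomial values -/

/-- Leibniz expansion of the Sylvester determinant: each of the `(m + n)!` products takes `m`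
entries from the columns of `g` and `n` from those of `f`. -/
lemma abs_resultant_le (f g : ℤ[X]) (m n : ℕ) :
    |(f.resultant g m n : ℝ)| ≤ (m + n).factorial * (g.supNorm ^ m * f.supNorm ^ n) := by
  have hb : ∀ σ : Equiv.Perm (Fin (m + n)),
      |((∏ i, f.sylvester g m n (σ i) i : ℤ) : ℝ)| ≤ g.supNorm ^ m * f.supNorm ^ n := by
    intro σ
    push_cast
    rw [Finset.abs_prod, Fin.prod_univ_add]
    refine mul_le_mul ?_ ?_ (Finset.prod_nonneg fun _ _ => abs_nonneg _)
      (pow_nonneg g.supNorm_nonneg _)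
    · refine (Finset.prod_le_prod (g := fun _ => g.supNorm) (fun _ _ => abs_nonneg _)
        fun i _ => ?_).trans (by simp)
      simp only [sylvester, Matrix.of_apply, Fin.addCases_left]
      split_ifs
      · exact abs_coeff_le_supNorm _ _
      · simpa using g.supNorm_nonneg
    · refine (Finset.prod_le_prod (g := fun _ => f.supNorm) (fun _ _ => abs_nonneg _)
        fun i _ => ?_).trans (by simp)
      simp only [sylvester, Matrix.of_apply, Fin.addCases_right]
      split_ifs
      · exact abs_coeff_le_supNorm _ _
      · simpa using f.supNorm_nonneg
  rw [resultant, Matrix.det_apply, Int.cast_sum]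
  refine (Finset.abs_sum_le_sum_abs _ _).trans ?_
  refine (Finset.sum_le_card_nsmul _ _ (g.supNorm ^ m * f.supNorm ^ n) fun σ _ => ?_).trans ?_
  · refine le_trans (le_of_eq ?_) (hb σ)
    rcases Int.units_eq_one_or (Equiv.Perm.sign σ) with h | h <;> simp [h]
  · rw [nsmul_eq_mul, Finset.card_univ, Fintype.card_perm, Fintype.card_fin]

lemma resultant_ne_zero_of_not_dvd {P F : ℤ[X]} (hP : Irreducible P) (hd : P.natDegree ≠ 0)
    (h : ¬ P ∣ F) : P.resultant F ≠ 0 := by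
  have hprim := hP.isPrimitive hd
  have hQ := (IsPrimitive.Int.irreducible_iff_irreducible_map_cast hprim).mp hP
  have hnd : ¬ P.map (Int.castRingHom ℚ) ∣ F.map (Int.castRingHom ℚ) := fun hc =>
    h ((IsPrimitive.Int.dvd_iff_map_cast_dvd_map_cast P F hprim).mpr hc)
  have hcop := hQ.coprime_iff_not_dvd.mpr hnd
  have := resultant_ne_zero _ _ hcop
  rw [natDegree_map_eq_of_injective Int.cast_injective,
    natDegree_map_eq_of_injective Int.cast_injective, resultant_map_map] at this
  intro h0
  exact this (by rw [h0]; simp)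

/-- A Liouville-type inequality: an irreducible integer polynomial and another one which it does
not divide cannot both be very small at the same `p`-adic integer. -/
lemma one_le_mul_max_of_not_dvd {p : ℕ} [Fact p.Prime] {ξ : ℚ_[p]} (hξ : ‖ξ‖ ≤ 1) {d : ℕ}
    {P F : ℤ[X]} (hP : Irreducible P) (hd : P.natDegree ≠ 0) (hPd : P.natDegree ≤ d)
    (hF : F.natDegree ≤ 2) (h : ¬ P ∣ F) :
    1 ≤ (d + 2).factorial * (F.supNorm ^ d * P.supNorm ^ 2) * max ‖aeval ξ P‖ ‖aeval ξ F‖ := by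
  have hF0 : F ≠ 0 := by rintro rfl; exact h (dvd_zero _)
  have hr := resultant_ne_zero_of_not_dvd hP hd h
  -- The resultant is an integral combination of `P` and `F`, so at `ξ` it is at most the larger of
  -- the two values.
  obtain ⟨A, B, -, -, hAB⟩ := exists_mul_add_mul_eq_C_resultant P F le_rfl le_rfl (Or.inl hd)
  set r := P.resultant F
  have h1 : (r : ℚ_[p]) = aeval ξ P * aeval ξ A + aeval ξ F * aeval ξ B := by
    have := congrArg (aeval ξ) hAB
    simpa using this.symm
  have h2 : ‖(r : ℚ_[p])‖ ≤ max ‖aeval ξ P‖ ‖aeval ξ F‖ := by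
    rw [h1]
    refine (Padic.nonarchimedean _ _).trans (max_le_max ?_ ?_) <;> rw [norm_mul]
    · exact mul_le_of_le_one_right (norm_nonneg _) (norm_aeval_le_one hξ A)
    · exact mul_le_of_le_one_right (norm_nonneg _) (norm_aeval_le_one hξ B)
  have h3 := one_div_abs_le_norm_intCast (p := p) hr
  have hrpos : 0 < |(r : ℝ)| := abs_pos.mpr (by exact_mod_cast hr)
  have hP1 := one_le_supNorm hP.ne_zero
  have hF1 := one_le_supNorm hF0
  have h4 : |(r : ℝ)| ≤ (d + 2).factorial * (F.supNorm ^ d * P.supNorm ^ 2) := by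
    refine (abs_resultant_le P F _ _).trans ?_
    gcongr
  have h5 : 1 ≤ |(r : ℝ)| * max ‖aeval ξ P‖ ‖aeval ξ F‖ := by
    have := h3.trans h2
    rwa [div_le_iff₀' hrpos] at this
  refine h5.trans ?_
  gcongr

/-- A lower bound for the values at `ξ` of the irreducible polynomials of degree at most `d` gives
one for those of all nonzero polynomials of degree at most `d`. -/
lemma exists_lower_bound_of_irreducible {p : ℕ} [Fact p.Prime] {ξ : ℚ_[p]} {d : ℕ} {c W : ℝ}
    (hc : 0 < c) (hW : 1 ≤ W)
    (h : ∀ P : ℤ[X], Irreducible P → P.natDegree ≠ 0 → P.natDegree ≤ d →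
      c * P.supNorm ^ (-W) ≤ ‖aeval ξ P‖) :
    ∃ c' : ℝ, 0 < c' ∧ ∀ P : ℤ[X], P ≠ 0 → P.natDegree ≤ d →
      c' * P.supNorm ^ (-W) ≤ ‖aeval ξ P‖ := by
  set M : ℤ[X] → ℝ := fun P => (P.map (Int.castRingHom ℂ)).mahlerMeasure with hM
  have hM1 : ∀ P : ℤ[X], P ≠ 0 → 1 ≤ M P := fun P hP => one_le_mahlerMeasure_of_ne_zero hP
  have hMmul : ∀ P Q : ℤ[X], M (P * Q) = M P * M Q := by
    intro P Q
    simp only [hM, Polynomial.map_mul, mahlerMeasure_mul]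
  -- The factor `(2 ^ d) ^ (-W)` is the price of passing from height to Mahler measure. Being at
  -- most `1`, `c₁` can be charged once per unit of degree, which is additive over the prime
  -- factors.
  set c₁ : ℝ := min 1 (c * (2 ^ d) ^ (-W)) with hc₁
  have hc₁0 : 0 < c₁ := by positivity
  have key : ∀ P : ℤ[X], P ≠ 0 → P.natDegree ≤ d →
      c₁ ^ P.natDegree * M P ^ (-W) ≤ ‖aeval ξ P‖ := by
    have hconst : ∀ P : ℤ[X], P ≠ 0 → P.natDegree = 0 →
        c₁ ^ P.natDegree * M P ^ (-W) ≤ ‖aeval ξ P‖ := by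
      intro P hP0 hPd
      rw [hPd, pow_zero, one_mul]
      obtain ⟨z, rfl⟩ := natDegree_eq_zero.mp hPd
      have hz : z ≠ 0 := by simpa using hP0
      have h1 := one_div_abs_le_norm_intCast (p := p) hz
      have hz1 : (1 : ℝ) ≤ |(z : ℝ)| := by exact_mod_cast Int.one_le_abs hz
      have h2 : M (C z) = |(z : ℝ)| := by
        change ((C z).map (Int.castRingHom ℂ)).mahlerMeasure = _
        rw [map_C, mahlerMeasure_const, eq_intCast, Complex.norm_intCast]
      rw [h2]
      have h3 : |(z : ℝ)| ^ (-W) ≤ |(z : ℝ)| ^ (-1 : ℝ) :=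
        Real.rpow_le_rpow_of_exponent_le hz1 (by linarith)
      rw [Real.rpow_neg_one, ← one_div] at h3
      simpa using h3.trans h1
    intro P
    induction P using UniqueFactorizationMonoid.induction_on_prime with
    | h₁ => intro h0; exact absurd rfl h0
    | h₂ x hx => intro h0 _; exact hconst x h0 (natDegree_eq_zero_of_isUnit hx)
    | h₃ a q ha hq ih =>
      intro h0 hdeg
      have hq0 := hq.ne_zero
      rw [natDegree_mul hq0 ha] at hdeg ⊢
      rw [hMmul, map_mul, norm_mul, pow_add,
        Real.mul_rpow (by linarith [hM1 q hq0]) (by linarith [hM1 a ha])]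
      have hqb : c₁ ^ q.natDegree * M q ^ (-W) ≤ ‖aeval ξ q‖ := by
        by_cases hqd : q.natDegree = 0
        · exact hconst q hq0 hqd
        refine le_trans ?_ (h q hq.irreducible hqd (by omega))
        have h1 : c₁ ^ q.natDegree ≤ c * (2 ^ d) ^ (-W) := by
          refine le_trans ?_ (min_le_right 1 _)
          exact pow_le_of_le_one hc₁0.le (min_le_left _ _) hqd
        have h2 : q.supNorm ≤ 2 ^ d * M q := supNorm_le_two_pow_mul_mahlerMeasure (by omega)
        have h3 : (2 ^ d * M q) ^ (-W) ≤ q.supNorm ^ (-W) :=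
          Real.rpow_le_rpow_of_nonpos (by linarith [one_le_supNorm hq0]) h2 (by linarith)
        rw [Real.mul_rpow (by positivity) (by linarith [hM1 q hq0])] at h3
        have h4 : 0 ≤ M q ^ (-W) := Real.rpow_nonneg (by linarith [hM1 q hq0]) _
        calc _ ≤ (c * (2 ^ d) ^ (-W)) * M q ^ (-W) := by gcongr
          _ = c * ((2 ^ d) ^ (-W) * M q ^ (-W)) := by ring
          _ ≤ _ := by gcongr
      have hab := ih ha (by omega)
      have h5 : 0 ≤ c₁ ^ a.natDegree * M a ^ (-W) :=
        mul_nonneg (by positivity) (Real.rpow_nonneg (by linarith [hM1 a ha]) _)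
      calc _ = (c₁ ^ q.natDegree * M q ^ (-W)) * (c₁ ^ a.natDegree * M a ^ (-W)) := by ring
        _ ≤ _ := mul_le_mul hqb hab h5 (norm_nonneg _)
  refine ⟨c₁ ^ d * (d + 1) ^ (-W), by positivity, fun P hP0 hPd => le_trans ?_ (key P hP0 hPd)⟩
  have hs := one_le_supNorm hP0
  have h1 : M P ≤ (d + 1) * P.supNorm := mahlerMeasure_le_mul_supNorm hPd
  have h2 : ((d + 1) * P.supNorm) ^ (-W) ≤ M P ^ (-W) :=
    Real.rpow_le_rpow_of_nonpos (by linarith [hM1 P hP0]) h1 (by linarith)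
  rw [Real.mul_rpow (by positivity) (by linarith)] at h2
  have h3 : c₁ ^ d ≤ c₁ ^ P.natDegree := pow_le_pow_of_le_one hc₁0.le (min_le_left _ _) hPd
  rw [mul_assoc]
  gcongr

/-! ### Minimal polynomials over `ℤ` -/

section intMinpoly

variable {p : ℕ} [Fact p.Prime] {α : ℚ_[p]}

lemma exists_map_intMinpoly (hα : IsAlgebraic ℚ α) :
    ∃ c : ℚ, c ≠ 0 ∧ minpoly ℚ α = C c * (intMinpoly α).map (Int.castRingHom ℚ) := by
  have hm : minpoly ℚ α ≠ 0 := minpoly.ne_zero hα.isIntegral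
  obtain ⟨b, hb, hbe⟩ := IsLocalization.integerNormalization_spec (nonZeroDivisors ℤ) (minpoly ℚ α)
  set N := IsLocalization.integerNormalization (nonZeroDivisors ℤ) (minpoly ℚ α) with hN
  have hb0 : b ≠ 0 := nonZeroDivisors.ne_zero hb
  have hcont : N.map (algebraMap ℤ ℚ) =
      C ((N.content : ℤ) : ℚ) * (intMinpoly α).map (Int.castRingHom ℚ) := by
    conv_lhs => rw [N.eq_C_content_mul_primPart]
    rw [Polynomial.map_mul, map_C]
    rfl
  have hN0 : N ≠ 0 := by
    intro h0
    rw [h0, Polynomial.map_zero] at hbe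
    rcases smul_eq_zero.mp hbe.symm with h | h
    · exact hb0 h
    · exact hm h
  have hc0 : N.content ≠ 0 := by simpa [content_eq_zero_iff] using hN0
  have hbQ : (b : ℚ) ≠ 0 := by exact_mod_cast hb0
  have hcQ : (N.content : ℚ) ≠ 0 := by exact_mod_cast hc0
  refine ⟨(b : ℚ)⁻¹ * N.content, by positivity, ?_⟩
  rw [C_mul, mul_assoc, ← hcont, hbe, ← Int.cast_smul_eq_zsmul ℚ, smul_eq_C_mul, ← mul_assoc,
    ← C_mul, inv_mul_cancel₀ hbQ, C_1, one_mul]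

lemma isPrimitive_intMinpoly : (intMinpoly α).IsPrimitive := isPrimitive_primPart _

lemma irreducible_intMinpoly (hα : IsAlgebraic ℚ α) : Irreducible (intMinpoly α) := by
  obtain ⟨c, hc, h⟩ := exists_map_intMinpoly hα
  rw [IsPrimitive.Int.irreducible_iff_irreducible_map_cast isPrimitive_intMinpoly]
  have := minpoly.irreducible hα.isIntegral
  rw [h] at this
  exact (irreducible_isUnit_mul (isUnit_C.mpr hc.isUnit)).mp this

lemma natDegree_intMinpoly (hα : IsAlgebraic ℚ α) :
    (intMinpoly α).natDegree = (minpoly ℚ α).natDegree := by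
  obtain ⟨c, hc, h⟩ := exists_map_intMinpoly hα
  rw [h, natDegree_C_mul hc, natDegree_map_eq_of_injective Int.cast_injective]

lemma natDegree_intMinpoly_ne_zero (hα : IsAlgebraic ℚ α) : (intMinpoly α).natDegree ≠ 0 := by
  rw [natDegree_intMinpoly hα]
  exact (minpoly.natDegree_pos hα.isIntegral).ne'

lemma aeval_map_castRingHom (P : ℤ[X]) :
    aeval α (P.map (Int.castRingHom ℚ)) = aeval α P := by
  rw [← algebraMap_int_eq, aeval_map_algebraMap]

lemma aeval_intMinpoly (hα : IsAlgebraic ℚ α) : aeval α (intMinpoly α) = 0 := by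
  obtain ⟨c, hc, h⟩ := exists_map_intMinpoly hα
  have h1 := minpoly.aeval ℚ α
  rw [h, map_mul, aeval_C, aeval_map_castRingHom] at h1
  rcases mul_eq_zero.mp h1 with h2 | h2
  · exact absurd ((map_eq_zero _).mp h2) hc
  · exact h2

lemma intMinpoly_dvd (hα : IsAlgebraic ℚ α) {P : ℤ[X]} (hP : aeval α P = 0) :
    intMinpoly α ∣ P := by
  obtain ⟨c, hc, h⟩ := exists_map_intMinpoly hα
  rw [IsPrimitive.Int.dvd_iff_map_cast_dvd_map_cast _ _ isPrimitive_intMinpoly]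
  have h1 : minpoly ℚ α ∣ P.map (Int.castRingHom ℚ) :=
    minpoly.dvd _ _ (by rw [aeval_map_castRingHom, hP])
  rw [h] at h1
  exact dvd_of_mul_left_dvd h1

end intMinpoly

/-! ### Numerators and denominators of the continued fraction -/

/-- The sequences satisfying the recurrence of the numerators and denominators of a Schneider
continued fraction. -/
def schneiderSeq (p : ℕ) (a : ℕ → ℕ) (x y : ℕ) : ℕ → ℕ
  | 0 => x
  | 1 => y
  | n + 2 => schneiderSeq p a x y (n + 1) + p ^ a (n + 1) * schneiderSeq p a x y n

/-- The sum `a 1 + ⋯ + a n`. -/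
def partialSum (a : ℕ → ℕ) (n : ℕ) : ℕ := ∑ k ∈ Finset.range n, a (k + 1)

lemma partialSum_succ (a : ℕ → ℕ) (n : ℕ) : partialSum a (n + 1) = partialSum a n + a (n + 1) :=
  Finset.sum_range_succ _ _

lemma partialSum_mono (a : ℕ → ℕ) : Monotone (partialSum a) :=
  monotone_nat_of_le_succ fun n => by rw [partialSum_succ]; omega

lemma self_le_partialSum {a : ℕ → ℕ} (ha : ∀ n, 1 ≤ n → 1 ≤ a n) (n : ℕ) :
    n ≤ partialSum a n := by
  induction n with
  | zero => simp
  | succ n ih => rw [partialSum_succ]; have := ha (n + 1) (by omega); omega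

/-- The expected size is the square root of `p ^ partialSum a k`, since one recurrence step of index
two multiplies by `p ^ a (k + 2)`. Because `a (k + 2) ≤ a (k + 1) + 5`, the square of that factor
exceeds `p ^ (a (k + 1) + a (k + 2))` by at most `p ^ 5`; the term `6 * k` absorbs this and the
doubling in the sum of two terms. -/
lemma schneiderSeq_sq_le {p : ℕ} (hp : 2 ≤ p) {a : ℕ → ℕ} {e : ℕ} (he : 2 ≤ e) (he1 : a 1 ≤ e)
    (ha : ∀ n, 1 ≤ n → a (n + 1) ≤ a n + 5) {x y : ℕ} (hx : x ≤ 1) (hy : y ≤ p) (k : ℕ) :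
    schneiderSeq p a x y (k + 1) ^ 2 ≤ p ^ (partialSum a k + 6 * k + e) := by
  have hsq : ∀ s t U i : ℕ, s ^ 2 ≤ p ^ U → t ^ 2 ≤ p ^ U → U + 2 ≤ i → (s + t) ^ 2 ≤ p ^ i := by
    intro s t U i hs ht hi
    calc (s + t) ^ 2 ≤ 2 * (s ^ 2 + t ^ 2) := add_sq_le
      _ ≤ 2 * (p ^ U + p ^ U) := by gcongr
      _ = 2 ^ 2 * p ^ U := by ring
      _ ≤ p ^ 2 * p ^ U := by gcongr
      _ = p ^ (2 + U) := (pow_add _ _ _).symm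
      _ ≤ p ^ i := Nat.pow_le_pow_right (by omega) (by omega)
  induction k using Nat.strong_induction_on with
  | _ k ih =>
    match k with
    | 0 =>
      calc y ^ 2 ≤ p ^ 2 := by gcongr
        _ ≤ _ := Nat.pow_le_pow_right (by omega) (by simp [partialSum, he])
    | 1 =>
      change (y + p ^ a 1 * x) ^ 2 ≤ _
      have hS : partialSum a 1 = a 1 := by simp [partialSum]
      refine hsq _ _ (2 * a 1 + 2) _ ?_ ?_ (by rw [hS]; omega)
      · calc y ^ 2 ≤ p ^ 2 := by gcongr
          _ ≤ _ := Nat.pow_le_pow_right (by omega) (by omega)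
      · calc (p ^ a 1 * x) ^ 2 ≤ (p ^ a 1 * 1) ^ 2 := by gcongr
          _ = p ^ (2 * a 1) := by rw [mul_one, ← pow_mul, mul_comm]
          _ ≤ _ := Nat.pow_le_pow_right (by omega) (by omega)
    | k + 2 =>
      change (schneiderSeq p a x y (k + 2) + p ^ a (k + 2) * schneiderSeq p a x y (k + 1)) ^ 2 ≤ _
      have h1 := ih (k + 1) (by omega)
      have h2 := ih k (by omega)
      have h3 : a (k + 2) ≤ a (k + 1) + 5 := ha (k + 1) (by omega)
      have hS1 : partialSum a (k + 2) = partialSum a (k + 1) + a (k + 2) := partialSum_succ a (k + 1)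
      have hS2 := partialSum_succ a k
      refine hsq _ _ (partialSum a (k + 2) + 6 * (k + 1) + e) _
        (h1.trans (Nat.pow_le_pow_right (by omega) (by omega))) ?_ (by omega)
      rw [mul_pow]
      calc _ ≤ (p ^ a (k + 2)) ^ 2 * p ^ (partialSum a k + 6 * k + e) := by gcongr
        _ = p ^ (2 * a (k + 2) + (partialSum a k + 6 * k + e)) := by
          rw [← pow_mul, ← pow_add, mul_comm 2]
        _ ≤ _ := Nat.pow_le_pow_right (by omega) (by omega)

lemma schneiderSeq_det (p : ℕ) (a : ℕ → ℕ) (b₀ k : ℕ) :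
    (schneiderSeq p a 1 b₀ (k + 1) * schneiderSeq p a 0 1 k
      - schneiderSeq p a 1 b₀ k * schneiderSeq p a 0 1 (k + 1) : ℤ)
      = (-1) ^ (k + 1) * p ^ partialSum a k := by
  induction k with
  | zero => simp [schneiderSeq, partialSum]
  | succ k ih =>
    rw [partialSum_succ]
    simp only [schneiderSeq]
    push_cast
    linear_combination (-(p : ℤ) ^ a (k + 1)) * ih

lemma not_dvd_schneiderSeq {p : ℕ} [Fact p.Prime] {a : ℕ → ℕ} (ha : ∀ n, 1 ≤ n → 1 ≤ a n)
    (k : ℕ) : ¬ p ∣ schneiderSeq p a 0 1 (k + 1) := by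
  induction k with
  | zero => simpa [schneiderSeq] using (Fact.out : p.Prime).one_lt.ne'
  | succ k ih =>
    simp only [schneiderSeq]
    have h : p ∣ p ^ a (k + 1) * schneiderSeq p a 0 1 k :=
      Dvd.dvd.mul_right (dvd_pow_self p (by have := ha (k + 1) (by omega); omega)) _
    rwa [Nat.dvd_add_left h]

/-! ### Convergence, and exact sizes of linear and quadratic forms at `ξ` -/

section convergence

variable {p : ℕ} [Fact p.Prime] {a : ℕ → ℕ}

lemma norm_schneiderSeq (ha : ∀ n, 1 ≤ n → 1 ≤ a n) (k : ℕ) :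
    ‖(schneiderSeq p a 0 1 (k + 1) : ℚ_[p])‖ = 1 := by
  have h := not_dvd_schneiderSeq (p := p) ha k
  have h1 := Padic.norm_natCast_lt_one_iff (p := p) (n := schneiderSeq p a 0 1 (k + 1))
  have h2 := Padic.norm_int_le_one (p := p) (schneiderSeq p a 0 1 (k + 1))
  push_cast at h2
  refine le_antisymm h2 (not_lt.mp fun h3 => h (h1.mp h3))

lemma contsAux_schneiderCF (b₀ k : ℕ) :
    (schneiderCF p b₀ a).contsAux k
      = ⟨(schneiderSeq p a 1 b₀ k : ℚ_[p]), (schneiderSeq p a 0 1 k : ℚ_[p])⟩ := by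
  induction k using Nat.strong_induction_on with
  | _ k ih =>
    match k with
    | 0 => simp [schneiderSeq]
    | 1 => simp [schneiderSeq, schneiderCF]
    | k + 2 =>
      have hs : (schneiderCF p b₀ a).s.get? k = some ⟨(p : ℚ_[p]) ^ a (k + 1), 1⟩ := rfl
      rw [GenContFract.contsAux_recurrence hs (ih k (by omega)) (ih (k + 1) (by omega))]
      simp [schneiderSeq]

lemma convs_schneiderCF (b₀ k : ℕ) :
    (schneiderCF p b₀ a).convs k
      = (schneiderSeq p a 1 b₀ (k + 1) : ℚ_[p]) / schneiderSeq p a 0 1 (k + 1) := by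
  rw [GenContFract.conv_eq_conts_a_div_conts_b, GenContFract.nth_cont_eq_succ_nth_contAux,
    contsAux_schneiderCF]

lemma norm_convs_succ_sub (ha : ∀ n, 1 ≤ n → 1 ≤ a n) (b₀ k : ℕ) :
    ‖(schneiderCF p b₀ a).convs (k + 1) - (schneiderCF p b₀ a).convs k‖
      = (p : ℝ) ^ (-(partialSum a (k + 1) : ℤ)) := by
  have h1 := norm_schneiderSeq (p := p) ha k
  have h2 := norm_schneiderSeq (p := p) ha (k + 1)
  have h10 : (schneiderSeq p a 0 1 (k + 1) : ℚ_[p]) ≠ 0 := by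
    intro h; rw [h] at h1; simp at h1
  have h20 : (schneiderSeq p a 0 1 (k + 1 + 1) : ℚ_[p]) ≠ 0 := by
    intro h; rw [h] at h2; simp at h2
  have hdet := congrArg (fun z : ℤ => (z : ℚ_[p])) (schneiderSeq_det p a b₀ (k + 1))
  push_cast at hdet
  rw [convs_schneiderCF, convs_schneiderCF, div_sub_div _ _ h20 h10, norm_div, norm_mul, h1, h2]
  rw [show ∀ u v w t : ℚ_[p], u * v - w * t = u * v - t * w by intros; ring, hdet]
  simp [norm_mul]

/-- Successive differences of convergents strictly decrease in absolute value, so by the ultrametric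
inequality the first one determines the size of the whole sum. -/
lemma norm_convs_add_sub (ha : ∀ n, 1 ≤ n → 1 ≤ a n) (b₀ k l : ℕ) :
    ‖(schneiderCF p b₀ a).convs (k + l + 1) - (schneiderCF p b₀ a).convs k‖
      = (p : ℝ) ^ (-(partialSum a (k + 1) : ℤ)) := by
  have hp1 : (1 : ℝ) < p := by exact_mod_cast (Fact.out : p.Prime).one_lt
  induction l with
  | zero => exact norm_convs_succ_sub ha b₀ k
  | succ l ih =>
    have h1 := norm_convs_succ_sub (p := p) ha b₀ (k + l + 1)
    have h2 : ‖(schneiderCF p b₀ a).convs (k + l + 1 + 1) - (schneiderCF p b₀ a).convs (k + l + 1)‖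
        < ‖(schneiderCF p b₀ a).convs (k + l + 1) - (schneiderCF p b₀ a).convs k‖ := by
      rw [h1, ih]
      apply zpow_lt_zpow_right₀ hp1
      have h3 := partialSum_mono a (show k + 1 ≤ k + l + 1 by omega)
      have h4 := partialSum_succ a (k + l + 1)
      have h5 := ha (k + l + 1 + 1) (by omega)
      omega
    rw [← ih, ← max_eq_right h2.le, ← Padic.add_eq_max_of_ne h2.ne]
    congr 1
    rw [show k + (l + 1) + 1 = k + l + 1 + 1 by omega]
    ring

lemma exists_isSchneiderValue (ha : ∀ n, 1 ≤ n → 1 ≤ a n) (b₀ : ℕ) :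
    ∃ ξ : ℚ_[p], IsSchneiderValue b₀ a ξ := by
  have hp1 : (1 : ℝ) < p := by exact_mod_cast (Fact.out : p.Prime).one_lt
  refine cauchySeq_tendsto_of_complete
    (cauchySeq_of_le_geometric ((p : ℝ)⁻¹) 1 (inv_lt_one_of_one_lt₀ hp1) fun k => ?_)
  rw [dist_comm, dist_eq_norm, norm_convs_succ_sub ha, one_mul, zpow_neg, zpow_natCast, inv_pow]
  gcongr
  · exact hp1.le
  · have := self_le_partialSum ha (k + 1); omega

/-- The linear form `D X - N` in a convergent `N / D`, evaluated at `ξ`. -/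
def convForm (a : ℕ → ℕ) (b₀ : ℕ) (ξ : ℚ_[p]) (k : ℕ) : ℚ_[p] :=
  schneiderSeq p a 0 1 k * ξ - schneiderSeq p a 1 b₀ k

lemma convForm_add_two (b₀ : ℕ) (ξ : ℚ_[p]) (k : ℕ) :
    convForm a b₀ ξ (k + 2) = convForm a b₀ ξ (k + 1) + p ^ a (k + 1) * convForm a b₀ ξ k := by
  simp only [convForm, schneiderSeq]
  push_cast
  ring

lemma norm_convForm (ha : ∀ n, 1 ≤ n → 1 ≤ a n) {b₀ : ℕ} {ξ : ℚ_[p]}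
    (hξ : IsSchneiderValue b₀ a ξ) (k : ℕ) :
    ‖convForm a b₀ ξ k‖ = (p : ℝ) ^ (-(partialSum a k : ℤ)) := by
  cases k with
  | zero => simp [convForm, schneiderSeq, partialSum]
  | succ k =>
    have h1 : Tendsto (fun l => ‖(schneiderCF p b₀ a).convs (l + (k + 1))
        - (schneiderCF p b₀ a).convs k‖) atTop (𝓝 ‖ξ - (schneiderCF p b₀ a).convs k‖) :=
      (((tendsto_add_atTop_iff_nat (k + 1)).mpr hξ).sub_const _).norm
    have h2 : (fun l => ‖(schneiderCF p b₀ a).convs (l + (k + 1))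
        - (schneiderCF p b₀ a).convs k‖) = fun _ => (p : ℝ) ^ (-(partialSum a (k + 1) : ℤ)) := by
      ext l
      rw [← norm_convs_add_sub ha b₀ k l]
      congr 3
      ring
    rw [h2] at h1
    have h3 := tendsto_nhds_unique h1 tendsto_const_nhds
    have h4 := norm_schneiderSeq (p := p) ha k
    have h40 : (schneiderSeq p a 0 1 (k + 1) : ℚ_[p]) ≠ 0 := by
      intro h; rw [h] at h4; simp at h4
    rw [← h3, convs_schneiderCF, convForm]
    rw [← one_mul ‖ξ - _‖, ← h4, ← norm_mul, mul_sub, mul_div_cancel₀ _ h40]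

lemma norm_le_one_of_isSchneiderValue (ha : ∀ n, 1 ≤ n → 1 ≤ a n) {b₀ : ℕ} {ξ : ℚ_[p]}
    (hξ : IsSchneiderValue b₀ a ξ) : ‖ξ‖ ≤ 1 := by
  have hp1 : (1 : ℝ) < p := by exact_mod_cast (Fact.out : p.Prime).one_lt
  have h := norm_convForm ha hξ 1
  have h1 : ‖convForm a b₀ ξ 1‖ ≤ 1 := by
    rw [h, zpow_neg, zpow_natCast]
    exact inv_le_one_of_one_le₀ (one_le_pow₀ hp1.le)
  have h2 : ξ = convForm a b₀ ξ 1 + ((b₀ : ℤ) : ℚ_[p]) := by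
    simp [convForm, schneiderSeq]
  rw [h2]
  exact (Padic.nonarchimedean _ _).trans (max_le h1 (Padic.norm_int_le_one _))

/-- The value at `ξ` of the quadratic form attached to the truncation at index `k`, continued
periodically with the partial quotient `c`. -/
def quadForm (a : ℕ → ℕ) (b₀ : ℕ) (ξ : ℚ_[p]) (c k : ℕ) : ℚ_[p] :=
  convForm a b₀ ξ (k + 1) ^ 2 - convForm a b₀ ξ (k + 1) * convForm a b₀ ξ k
    - p ^ c * convForm a b₀ ξ k ^ 2

/-- As long as the next partial quotient is `c`, moving the index one step multiplies the form by
`-p ^ c`. This transports the computation to the end of the block, where the next partial quotient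
exceeds `c` and the term `p ^ c * convForm ^ 2` strictly dominates. -/
lemma norm_quadForm (ha : ∀ n, 1 ≤ n → 1 ≤ a n) {b₀ : ℕ} {ξ : ℚ_[p]}
    (hξ : IsSchneiderValue b₀ a ξ) {c : ℕ} (l k : ℕ)
    (hc : ∀ n, k < n → n < k + l + 1 → a n = c) (hlt : c < a (k + l + 1)) :
    ‖quadForm a b₀ ξ c k‖ = (p : ℝ) ^ (-(2 * partialSum a k + c * (l + 1) : ℤ)) := by
  have hp1 : (1 : ℝ) < p := by exact_mod_cast (Fact.out : p.Prime).one_lt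
  have hp0 : (p : ℝ) ≠ 0 := by positivity
  induction l generalizing k with
  | zero =>
    have h0 := norm_convForm ha hξ k
    have h1 := norm_convForm ha hξ (k + 1)
    have hS := partialSum_succ a k
    rw [add_zero] at hlt
    have hc0 : ‖(p : ℚ_[p]) ^ c * convForm a b₀ ξ k ^ 2‖
        = (p : ℝ) ^ (-(2 * partialSum a k + c * ((0 : ℕ) + 1) : ℤ)) := by
      rw [norm_mul, norm_pow, norm_pow, Padic.norm_p, h0, inv_pow, ← zpow_natCast, ← zpow_neg,
        ← zpow_natCast, ← zpow_mul, ← zpow_add₀ hp0]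
      congr 1; push_cast; ring
    have hlt1 : ‖convForm a b₀ ξ (k + 1) ^ 2 - convForm a b₀ ξ (k + 1) * convForm a b₀ ξ k‖
        < ‖-((p : ℚ_[p]) ^ c * convForm a b₀ ξ k ^ 2)‖ := by
      rw [norm_neg, hc0]
      have h01 : ‖convForm a b₀ ξ (k + 1) - convForm a b₀ ξ k‖ ≤ ‖convForm a b₀ ξ k‖ := by
        rw [sub_eq_add_neg]
        refine (Padic.nonarchimedean _ _).trans (max_le ?_ (norm_neg _).le)
        rw [h0, h1]
        exact zpow_le_zpow_right₀ hp1.le (by omega)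
      rw [pow_two, ← mul_sub, norm_mul]
      calc _ ≤ ‖convForm a b₀ ξ (k + 1)‖ * ‖convForm a b₀ ξ k‖ := by gcongr
        _ = (p : ℝ) ^ (-(partialSum a (k + 1) : ℤ) + -(partialSum a k : ℤ)) := by
          rw [h0, h1, zpow_add₀ hp0]
        _ < _ := zpow_lt_zpow_right₀ hp1 (by push_cast; omega)
    rw [quadForm, sub_eq_add_neg, Padic.add_eq_max_of_ne hlt1.ne, max_eq_right hlt1.le, norm_neg,
      hc0]
  | succ l ih =>
    have hk := hc (k + 1) (by omega) (by omega)
    have h1 := ih (k + 1) (fun n h1 h2 => hc n (by omega) (by omega))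
      (by rw [show k + 1 + l + 1 = k + (l + 1) + 1 by omega]; exact hlt)
    have h2 : quadForm a b₀ ξ c (k + 1) = -(p ^ c * quadForm a b₀ ξ c k) := by
      simp only [quadForm, convForm_add_two, hk]
      ring
    rw [h2, norm_neg, norm_mul, norm_pow, Padic.norm_p, inv_pow, ← zpow_natCast,
      inv_mul_eq_iff_eq_mul₀ (by positivity), ← zpow_add₀ hp0, partialSum_succ, hk] at h1
    rw [h1]
    congr 1; push_cast; ring

end convergence

/-! ### Quadratics with non-square discriminant -/

/-- A square root `2 s + 1` would give `s (s + 1) = p ^ c` with coprime factors, so one of them is a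
unit and the product is `0` or `2`. The exponent `1` must be excluded: `1 + 4 * 2 = 3 ^ 2`. -/
lemma one_add_four_mul_prime_pow_ne_sq {p c : ℕ} (hp : p.Prime) (hc : 2 ≤ c) (t : ℤ) :
    1 + 4 * (p : ℤ) ^ c ≠ t ^ 2 := by
  intro h
  obtain ⟨s, rfl⟩ : ∃ s, t = 2 * s + 1 := by
    rcases Int.even_or_odd' t with ⟨s, hs | hs⟩
    · exfalso
      rw [hs, mul_pow] at h
      omega
    · exact ⟨s, hs⟩
  have h1 : s * (s + 1) = (p : ℤ) ^ c := by
    linarith [h, show (2 * s + 1) ^ 2 = 4 * (s * (s + 1)) + 1 by ring]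
  have h2 : (4 : ℤ) ≤ (p : ℤ) ^ c := by
    have : 2 ^ 2 ≤ p ^ c :=
      (Nat.pow_le_pow_left hp.two_le 2).trans (Nat.pow_le_pow_right hp.pos hc)
    exact_mod_cast this
  have hpp := Nat.prime_iff_prime_int.mp hp
  by_cases hps : (p : ℤ) ∣ s
  · have hcop : IsCoprime (s + 1) ((p : ℤ) ^ c) := by
      refine IsCoprime.pow_right ((hpp.coprime_iff_not_dvd.mpr fun hd => ?_).symm)
      have : (p : ℤ) ∣ 1 := by simpa using dvd_sub hd hps
      exact hpp.not_dvd_one this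
    have hu := hcop.isUnit_of_dvd' dvd_rfl ⟨s, by rw [← h1]; ring⟩
    rcases Int.isUnit_iff.mp hu with h3 | h3
    · have : s = 0 := by omega
      subst this; omega
    · have : s = -2 := by omega
      subst this; omega
  · have hcop : IsCoprime s ((p : ℤ) ^ c) :=
      IsCoprime.pow_right (hpp.coprime_iff_not_dvd.mpr hps).symm
    have hu := hcop.isUnit_of_dvd' dvd_rfl ⟨s + 1, h1.symm⟩
    rcases Int.isUnit_iff.mp hu with h3 | h3
    · subst h3; omega
    · subst h3; omega

/-- The polynomial `a X ^ 2 + b X + c`. -/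
def quadratic (a b c : ℤ) : ℤ[X] := C a * X ^ 2 + C b * X + C c

lemma natDegree_quadratic_eq {a : ℤ} (ha : a ≠ 0) (b c : ℤ) : (quadratic a b c).natDegree = 2 :=
  natDegree_quadratic ha

lemma eq_quadratic_of_natDegree_le {P : ℤ[X]} (h : P.natDegree ≤ 2) :
    P = quadratic (P.coeff 2) (P.coeff 1) (P.coeff 0) := by
  rw [quadratic, P.as_sum_range_C_mul_X_pow' (show P.natDegree < 3 by omega)]
  simp [Finset.sum_range_succ, coeff_X, coeff_X_pow, coeff_C, -eq_intCast]
  ring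

lemma aeval_quadratic {p : ℕ} [Fact p.Prime] (x : ℚ_[p]) (a b c : ℤ) :
    aeval x (quadratic a b c) = a * x ^ 2 + b * x + c := by
  simp [quadratic]

lemma supNorm_quadratic_le {a b c : ℤ} {B : ℝ} (ha : |(a : ℝ)| ≤ B) (hb : |(b : ℝ)| ≤ B)
    (hc : |(c : ℝ)| ≤ B) : (quadratic a b c).supNorm ≤ B := by
  refine supNorm_le_of_coeff_le fun i => ?_
  have h0 : 0 ≤ B := (abs_nonneg _).trans ha
  match i with
  | 0 => simpa [quadratic] using hc
  | 1 => simpa [quadratic, coeff_X, coeff_C, coeff_X_pow, -eq_intCast] using hb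
  | 2 => simpa [quadratic, coeff_X, coeff_C, coeff_X_pow, -eq_intCast] using ha
  | i + 3 => simpa [quadratic, coeff_X, coeff_C, coeff_X_pow, -eq_intCast] using h0

lemma quadratic_coeffs (a b c : ℤ) : (quadratic a b c).coeff 2 = a ∧
    (quadratic a b c).coeff 1 = b ∧ (quadratic a b c).coeff 0 = c := by
  simp [quadratic, coeff_X, coeff_C, coeff_X_pow, -eq_intCast]

lemma exists_eq_C_mul_of_dvd_quadratic {a b c : ℤ} (ha : a ≠ 0)
    (hsq : ∀ t : ℤ, b ^ 2 - 4 * a * c ≠ t ^ 2) {P : ℤ[X]} (hd : P.natDegree ≠ 0)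
    (h : P ∣ quadratic a b c) : ∃ k : ℤ, quadratic a b c = C k * P ∧ P.natDegree = 2 := by
  obtain ⟨Q, hQ⟩ := h
  have hdeg := natDegree_quadratic_eq ha b c
  have hF0 : quadratic a b c ≠ 0 := by
    intro h0; rw [h0] at hdeg; simp at hdeg
  have hP0 : P ≠ 0 := by rintro rfl; simp at hd
  have hQ0 : Q ≠ 0 := by rintro rfl; exact hF0 (by rw [hQ, mul_zero])
  have hdd : P.natDegree + Q.natDegree = 2 := by rw [← natDegree_mul hP0 hQ0, ← hQ, hdeg]
  rcases (show P.natDegree = 2 ∨ P.natDegree = 1 by omega) with h2 | h1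
  · obtain ⟨k, rfl⟩ := natDegree_eq_zero.mp (show Q.natDegree = 0 by omega)
    exact ⟨k, by rw [hQ, mul_comm], h2⟩
  · exfalso
    obtain ⟨u, v, rfl⟩ := exists_eq_X_add_C_of_natDegree_le_one (show P.natDegree ≤ 1 by omega)
    obtain ⟨s, t, rfl⟩ := exists_eq_X_add_C_of_natDegree_le_one (show Q.natDegree ≤ 1 by omega)
    have hmul : quadratic a b c = quadratic (u * s) (u * t + v * s) (v * t) := by
      rw [hQ]; simp only [quadratic, map_add, map_mul]; ring
    have e1 := quadratic_coeffs a b c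
    rw [hmul] at e1
    have e2 := quadratic_coeffs (u * s) (u * t + v * s) (v * t)
    refine hsq (u * t - v * s) ?_
    rw [← e1.1, ← e1.2.1, ← e1.2.2, e2.1, e2.2.1, e2.2.2]
    ring

/-! ### Divisors and `p`-adic roots of the quadratics -/

section padic

variable {p : ℕ} [Fact p.Prime]

lemma norm_one_add_four_mul_pow {c : ℕ} (hc : c ≠ 0) :
    ‖(1 + 4 * (p : ℚ_[p]) ^ c)‖ = 1 := by
  have h1 : ‖(4 * (p : ℚ_[p]) ^ c)‖ < 1 := by
    have h4 : ‖(4 : ℚ_[p])‖ ≤ 1 := by simpa using Padic.norm_int_le_one (p := p) 4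
    have hp1 : ‖(p : ℚ_[p]) ^ c‖ < 1 := by
      rw [norm_pow]
      exact pow_lt_one₀ (norm_nonneg _) Padic.norm_p_lt_one hc
    rw [norm_mul]
    calc _ ≤ 1 * ‖(p : ℚ_[p]) ^ c‖ := by gcongr
      _ < 1 := by rwa [one_mul]
  have h2 : ‖(1 : ℚ_[p])‖ = 1 := norm_one
  rw [Padic.add_eq_max_of_ne (by rw [h2]; exact h1.ne'), h2, max_eq_left h1.le]

/-- The quadratic polynomial `quadratic a b c` has discriminant `(1 + 4 p ^ e) p ^ (2 s)` and a
leading coefficient whose `p`-adic absolute value is `p ^ (-e)`. -/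
structure IsSchneiderQuadratic (p : ℕ) [Fact p.Prime] (e s : ℕ) (F : ℤ[X]) : Prop where
  natDegree_le : F.natDegree ≤ 2
  disc : F.coeff 1 ^ 2 - 4 * F.coeff 2 * F.coeff 0 = (1 + 4 * (p : ℤ) ^ e) * (p ^ s) ^ 2
  norm_leading : ‖(F.coeff 2 : ℚ_[p])‖ = (p : ℝ) ^ (-(e : ℤ))

namespace IsSchneiderQuadratic

variable {e s : ℕ} {F : ℤ[X]}

lemma coeff_two_ne_zero (hF : IsSchneiderQuadratic p e s F) : F.coeff 2 ≠ 0 := by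
  have hp0 : (0 : ℝ) < p := by exact_mod_cast (Fact.out : p.Prime).pos
  intro h
  have h1 := hF.norm_leading
  rw [h, Int.cast_zero, norm_zero] at h1
  exact (zpow_pos hp0 _).ne h1

lemma ne_zero (hF : IsSchneiderQuadratic p e s F) : F ≠ 0 := by
  intro h
  exact hF.coeff_two_ne_zero (by simp [h])

lemma aeval_eq (hF : IsSchneiderQuadratic p e s F) (x : ℚ_[p]) :
    aeval x F = F.coeff 2 * x ^ 2 + F.coeff 1 * x + F.coeff 0 := by
  conv_lhs => rw [eq_quadratic_of_natDegree_le hF.natDegree_le]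
  exact aeval_quadratic _ _ _ _

lemma disc_padic (hF : IsSchneiderQuadratic p e s F) :
    (F.coeff 1 : ℚ_[p]) ^ 2 - 4 * F.coeff 2 * F.coeff 0
      = (1 + 4 * (p : ℚ_[p]) ^ e) * (p ^ s) ^ 2 := by
  have h := congrArg (fun z : ℤ => (z : ℚ_[p])) hF.disc
  push_cast at h
  exact h

lemma norm_disc (hF : IsSchneiderQuadratic p e s F) (he : e ≠ 0) :
    ‖((F.coeff 1 : ℚ_[p]) ^ 2 - 4 * F.coeff 2 * F.coeff 0)‖ = ((p : ℝ) ^ (-(s : ℤ))) ^ 2 := by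
  rw [hF.disc_padic, norm_mul, norm_one_add_four_mul_pow he, one_mul, norm_pow, norm_pow,
    Padic.norm_p, inv_pow, zpow_neg, zpow_natCast]

lemma exists_eq_C_mul (hF : IsSchneiderQuadratic p e s F) (he : 2 ≤ e) {P : ℤ[X]}
    (hd : P.natDegree ≠ 0) (h : P ∣ F) : ∃ k : ℤ, k ≠ 0 ∧ F = C k * P ∧ P.natDegree = 2 := by
  have hp0 : (p : ℤ) ≠ 0 := by exact_mod_cast (Fact.out : p.Prime).ne_zero
  have hsq : ∀ t : ℤ, F.coeff 1 ^ 2 - 4 * F.coeff 2 * F.coeff 0 ≠ t ^ 2 := by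
    intro t ht
    rw [hF.disc] at ht
    have h1 : ((p : ℤ) ^ s) ^ 2 ∣ t ^ 2 := ⟨1 + 4 * (p : ℤ) ^ e, by rw [← ht]; ring⟩
    obtain ⟨r, rfl⟩ := (Int.pow_dvd_pow_iff (by norm_num)).mp h1
    refine one_add_four_mul_prime_pow_ne_sq Fact.out he r
      (mul_right_cancel₀ (pow_ne_zero 2 (pow_ne_zero s hp0)) (ht.trans ?_))
    ring
  have hq := eq_quadratic_of_natDegree_le hF.natDegree_le
  rw [hq] at h
  obtain ⟨k, hk, h2⟩ := exists_eq_C_mul_of_dvd_quadratic hF.coeff_two_ne_zero hsq hd h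
  rw [← hq] at hk
  refine ⟨k, ?_, hk, h2⟩
  rintro rfl
  exact hF.ne_zero (by simpa using hk)

lemma norm_aeval_le_of_dvd (hF : IsSchneiderQuadratic p e s F) (he : 2 ≤ e) {P : ℤ[X]}
    (hd : P.natDegree ≠ 0) (h : P ∣ F) (x : ℚ_[p]) : ‖aeval x F‖ ≤ ‖aeval x P‖ := by
  obtain ⟨k, -, hk, -⟩ := hF.exists_eq_C_mul he hd h
  rw [hk, map_mul, norm_mul]
  refine mul_le_of_le_one_left (norm_nonneg _) ?_
  simpa using Padic.norm_int_le_one (p := p) k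

/-- Write `F = k P`. The constant `k` divides the leading coefficient of `F`, so it carries at most
`p ^ e`; hence the discriminant of `P` is still divisible by a large power of `p`. It is a nonzero
integer of absolute value at most `5 H(P) ^ 2`, so `H(P)` must be large. -/
lemma pow_le_mul_supNorm_of_dvd (hF : IsSchneiderQuadratic p e s F) (he : 2 ≤ e) {P : ℤ[X]}
    (hd : P.natDegree ≠ 0) (h : P ∣ F) : (p : ℝ) ^ s ≤ 3 * p ^ e * P.supNorm := by
  have hp0 : (0 : ℝ) < p := by exact_mod_cast (Fact.out : p.Prime).pos
  obtain ⟨k, hk0, hk, -⟩ := hF.exists_eq_C_mul he hd h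
  set D : ℤ := P.coeff 1 ^ 2 - 4 * P.coeff 2 * P.coeff 0 with hD
  have hkn : (p : ℝ) ^ (-(e : ℤ)) ≤ ‖(k : ℚ_[p])‖ := by
    rw [← hF.norm_leading, hk, coeff_C_mul, Int.cast_mul, norm_mul]
    exact mul_le_of_le_one_right (norm_nonneg _) (Padic.norm_int_le_one _)
  have h1 : ‖(k : ℚ_[p])‖ ^ 2 * ‖(D : ℚ_[p])‖ = ((p : ℝ) ^ (-(s : ℤ))) ^ 2 := by
    rw [← hF.norm_disc (by omega), hk, ← norm_pow, ← norm_mul]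
    simp only [coeff_C_mul, hD]
    push_cast
    congr 1
    ring
  have hD0 : D ≠ 0 := by
    intro h0
    rw [h0, Int.cast_zero, norm_zero, mul_zero] at h1
    exact (pow_pos (zpow_pos hp0 _) 2).ne h1
  have h2 := one_div_abs_le_norm_intCast (p := p) hD0
  have hDpos : 0 < |(D : ℝ)| := abs_pos.mpr (by exact_mod_cast hD0)
  rw [div_le_iff₀ hDpos] at h2
  have h3 : |(D : ℝ)| ≤ 5 * P.supNorm ^ 2 := by
    have b0 := abs_coeff_le_supNorm P 0
    have b1 := abs_coeff_le_supNorm P 1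
    have b2 := abs_coeff_le_supNorm P 2
    have hn := P.supNorm_nonneg
    rw [hD]
    push_cast
    calc _ ≤ |(P.coeff 1 : ℝ) ^ 2| + |4 * (P.coeff 2 : ℝ) * P.coeff 0| := abs_sub _ _
      _ = |(P.coeff 1 : ℝ)| ^ 2 + 4 * (|(P.coeff 2 : ℝ)| * |(P.coeff 0 : ℝ)|) := by
        rw [abs_pow, abs_mul, abs_mul]; norm_num; ring
      _ ≤ P.supNorm ^ 2 + 4 * (P.supNorm * P.supNorm) := by gcongr
      _ = _ := by ring
  have h4 : ((p : ℝ) ^ (-(e : ℤ))) ^ 2 ≤ (5 * P.supNorm ^ 2) * ((p : ℝ) ^ (-(s : ℤ))) ^ 2 := by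
    calc _ ≤ ‖(k : ℚ_[p])‖ ^ 2 := by gcongr
      _ ≤ ‖(k : ℚ_[p])‖ ^ 2 * (‖(D : ℚ_[p])‖ * |(D : ℝ)|) :=
        le_mul_of_one_le_right (by positivity) h2
      _ = |(D : ℝ)| * ((p : ℝ) ^ (-(s : ℤ))) ^ 2 := by rw [← h1]; ring
      _ ≤ _ := by gcongr
  rw [zpow_neg, zpow_neg, zpow_natCast, zpow_natCast, inv_pow, inv_pow, ← div_eq_mul_inv,
    inv_le_iff_one_le_mul₀ (by positivity), div_mul_eq_mul_div, le_div_iff₀ (by positivity)] at h4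
  refine (abs_le_of_sq_le_sq' ?_ ?_).2
  -- The squared inequality has constant `5`, which is below `3 ^ 2`.
  · nlinarith [sq_nonneg ((p : ℝ) ^ e * P.supNorm)]
  · have := P.supNorm_nonneg; positivity

/-- At a root, the square of the derivative equals the discriminant, so the derivative has absolute
value `p ^ (-s)`. Near the root `F` therefore contracts at least by that factor; far from it,
`hsmall` suffices. -/
lemma le_norm_sub_of_root (hF : IsSchneiderQuadratic p e s F) (he : e ≠ 0) {ξ β : ℚ_[p]}
    (hβ : aeval β F = 0)
    (hsmall : ‖aeval ξ F‖ ≤ ((p : ℝ) ^ (-(s : ℤ))) ^ 2) :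
    (p : ℝ) ^ s * ‖aeval ξ F‖ ≤ ‖ξ - β‖ := by
  have hp0 : (0 : ℝ) < p := by exact_mod_cast (Fact.out : p.Prime).pos
  have hs : (p : ℝ) ^ (-(s : ℤ)) = ((p : ℝ) ^ s)⁻¹ := by rw [zpow_neg, zpow_natCast]
  have hps : (0 : ℝ) < (p : ℝ) ^ s := by positivity
  rw [hF.aeval_eq] at hβ
  by_cases h : ‖ξ - β‖ ≤ (p : ℝ) ^ (-(s : ℤ))
  · have h1 : aeval ξ F = (ξ - β) * ((2 * F.coeff 2 * β + F.coeff 1) + F.coeff 2 * (ξ - β)) := by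
      rw [hF.aeval_eq]; linear_combination hβ
    have h2 : ‖(2 * F.coeff 2 * β + F.coeff 1 : ℚ_[p])‖ = (p : ℝ) ^ (-(s : ℤ)) := by
      rw [← pow_left_inj₀ (norm_nonneg _) (zpow_nonneg hp0.le _) two_ne_zero,
        ← hF.norm_disc he, ← norm_pow]
      congr 1
      linear_combination 4 * (F.coeff 2 : ℚ_[p]) * hβ
    have h3 : ‖((2 * F.coeff 2 * β + F.coeff 1) + F.coeff 2 * (ξ - β) : ℚ_[p])‖
        ≤ (p : ℝ) ^ (-(s : ℤ)) := by
      refine (Padic.nonarchimedean _ _).trans (max_le h2.le ?_)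
      rw [norm_mul]
      exact (mul_le_of_le_one_left (norm_nonneg _) (Padic.norm_int_le_one _)).trans h
    rw [h1, norm_mul]
    calc _ ≤ (p : ℝ) ^ s * (‖ξ - β‖ * (p : ℝ) ^ (-(s : ℤ))) := by gcongr
      _ = ‖ξ - β‖ := by rw [hs]; field_simp
  · refine le_trans ?_ (not_le.mp h).le
    calc _ ≤ (p : ℝ) ^ s * ((p : ℝ) ^ (-(s : ℤ))) ^ 2 := by gcongr
      _ = _ := by rw [hs]; field_simp

/-- The identity `F'(ξ) ^ 2 = disc F + 4 * F.coeff 2 * F(ξ)` and the smallness of `F(ξ)` give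
`|F'(ξ)| = p ^ (-s)`, which is what Hensel's lemma needs. -/
lemma exists_root (hF : IsSchneiderQuadratic p e s F) (he : e ≠ 0) {ξ : ℚ_[p]} (hξ : ‖ξ‖ ≤ 1)
    (hsmall : ‖aeval ξ F‖ < ((p : ℝ) ^ (-(s : ℤ))) ^ 2) :
    ∃ α : ℚ_[p], aeval α F = 0 ∧ ‖ξ - α‖ ≤ (p : ℝ) ^ s * ‖aeval ξ F‖ := by
  have hp0 : (0 : ℝ) < p := by exact_mod_cast (Fact.out : p.Prime).pos
  have hs : (p : ℝ) ^ (-(s : ℤ)) = ((p : ℝ) ^ s)⁻¹ := by rw [zpow_neg, zpow_natCast]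
  have hps : (0 : ℝ) < (p : ℝ) ^ s := by positivity
  obtain ⟨x, rfl⟩ : ∃ x : ℤ_[p], (x : ℚ_[p]) = ξ := ⟨⟨ξ, hξ⟩, rfl⟩
  have hcoe : ∀ (y : ℤ_[p]) (P : ℤ[X]), aeval (y : ℚ_[p]) P = ((aeval y P : ℤ_[p]) : ℚ_[p]) :=
    fun y P => aeval_algebraMap_apply ℚ_[p] y P
  have hder : aeval (x : ℚ_[p]) (derivative F) = 2 * F.coeff 2 * (x : ℚ_[p]) + F.coeff 1 := by
    conv_lhs => rw [eq_quadratic_of_natDegree_le hF.natDegree_le]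
    simp [quadratic, map_ofNat]
    ring
  have h2 : ‖aeval (x : ℚ_[p]) (derivative F)‖ = (p : ℝ) ^ (-(s : ℤ)) := by
    have h4 : ‖(4 * F.coeff 2 * aeval (x : ℚ_[p]) F : ℚ_[p])‖
        < ‖((F.coeff 1 : ℚ_[p]) ^ 2 - 4 * F.coeff 2 * F.coeff 0)‖ := by
      rw [hF.norm_disc he, norm_mul]
      refine lt_of_le_of_lt (mul_le_of_le_one_left (norm_nonneg _) ?_) hsmall
      simpa using Padic.norm_int_le_one (p := p) (4 * F.coeff 2)
    rw [← pow_left_inj₀ (norm_nonneg _) (zpow_nonneg hp0.le _) two_ne_zero,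
      ← hF.norm_disc he, ← norm_pow, hder, ← max_eq_left h4.le, ← Padic.add_eq_max_of_ne h4.ne']
    congr 1
    rw [hF.aeval_eq]
    ring
  have hH : ‖aeval x F‖ < ‖aeval x (derivative F)‖ ^ 2 := by
    have h3 : ‖aeval x F‖ = ‖aeval (x : ℚ_[p]) F‖ := by rw [hcoe]; rfl
    have h4 : ‖aeval x (derivative F)‖ = ‖aeval (x : ℚ_[p]) (derivative F)‖ := by rw [hcoe]; rfl
    rw [h3, h4, h2]
    exact hsmall
  obtain ⟨z, hz, hzx, -, -⟩ := hensels_lemma hH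
  have hzx' : ‖(z : ℚ_[p]) - x‖ < (p : ℝ) ^ (-(s : ℤ)) := by
    rw [← h2, hcoe, ← PadicInt.coe_sub]
    exact hzx
  have hz' : aeval (z : ℚ_[p]) F = 0 := by rw [hcoe, hz]; simp
  refine ⟨z, hz', ?_⟩
  rw [hF.aeval_eq] at hz'
  have h5 : aeval (x : ℚ_[p]) F
      = (x - z) * (aeval (x : ℚ_[p]) (derivative F) + F.coeff 2 * (z - x)) := by
    rw [hF.aeval_eq, hder]
    linear_combination hz'
  have h6 : ‖(F.coeff 2 : ℚ_[p]) * (z - x)‖ < ‖aeval (x : ℚ_[p]) (derivative F)‖ := by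
    rw [h2, norm_mul]
    exact lt_of_le_of_lt (mul_le_of_le_one_left (norm_nonneg _) (Padic.norm_int_le_one _)) hzx'
  rw [h5, norm_mul, Padic.add_eq_max_of_ne h6.ne', max_eq_left h6.le, h2, hs]
  apply le_of_eq
  field_simp

end IsSchneiderQuadratic

end padic

/-! ### Quadratics attached to periodic continuations -/

/-- The integer quadratic polynomial whose value at `ξ` is `quadForm a b₀ ξ c k`. -/
def schneiderPoly (p : ℕ) (a : ℕ → ℕ) (b₀ c k : ℕ) : ℤ[X] :=
  let q : ℤ := schneiderSeq p a 0 1 (k + 1)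
  let q' : ℤ := schneiderSeq p a 0 1 k
  let r : ℤ := schneiderSeq p a 1 b₀ (k + 1)
  let r' : ℤ := schneiderSeq p a 1 b₀ k
  quadratic (q ^ 2 - q * q' - p ^ c * q' ^ 2) (q * r' + q' * r - 2 * (q * r) + 2 * (p ^ c * (q' * r')))
    (r ^ 2 - r * r' - p ^ c * r' ^ 2)

lemma aeval_schneiderPoly {p : ℕ} [Fact p.Prime] (a : ℕ → ℕ) (b₀ c k : ℕ) (ξ : ℚ_[p]) :
    aeval ξ (schneiderPoly p a b₀ c k) = quadForm a b₀ ξ c k := by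
  rw [schneiderPoly, aeval_quadratic]
  simp only [quadForm, convForm]
  push_cast
  ring

/-- The polynomial is the form `X ^ 2 - X Y - p ^ c Y ^ 2`, of discriminant `1 + 4 p ^ c`, composed
with two linear forms of determinant `± p ^ partialSum a (k + 1)`. In the leading coefficient, `q ^
2 - q q'` is divisible by `p ^ a (k + 1)`, hence negligible against `p ^ c q' ^ 2`, as `q'` is a
`p`-adic unit. -/
lemma isSchneiderQuadratic_schneiderPoly {p : ℕ} [Fact p.Prime] {a : ℕ → ℕ}
    (ha : ∀ n, 1 ≤ n → 1 ≤ a n) (b₀ : ℕ) {c k : ℕ} (hc : c < a (k + 1)) :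
    IsSchneiderQuadratic p c (partialSum a (k + 1)) (schneiderPoly p a b₀ c (k + 1)) := by
  have hp1 : (1 : ℝ) < p := by exact_mod_cast (Fact.out : p.Prime).one_lt
  refine ⟨natDegree_quadratic_le, ?_, ?_⟩
  · obtain ⟨h1, h2, h3⟩ := quadratic_coeffs
      ((schneiderSeq p a 0 1 (k + 1 + 1) : ℤ) ^ 2
        - (schneiderSeq p a 0 1 (k + 1 + 1) : ℤ) * schneiderSeq p a 0 1 (k + 1)
        - p ^ c * (schneiderSeq p a 0 1 (k + 1) : ℤ) ^ 2)
      ((schneiderSeq p a 0 1 (k + 1 + 1) : ℤ) * schneiderSeq p a 1 b₀ (k + 1)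
        + (schneiderSeq p a 0 1 (k + 1) : ℤ) * schneiderSeq p a 1 b₀ (k + 1 + 1)
        - 2 * ((schneiderSeq p a 0 1 (k + 1 + 1) : ℤ) * schneiderSeq p a 1 b₀ (k + 1 + 1))
        + 2 * (p ^ c * ((schneiderSeq p a 0 1 (k + 1) : ℤ) * schneiderSeq p a 1 b₀ (k + 1))))
      ((schneiderSeq p a 1 b₀ (k + 1 + 1) : ℤ) ^ 2
        - (schneiderSeq p a 1 b₀ (k + 1 + 1) : ℤ) * schneiderSeq p a 1 b₀ (k + 1)
        - p ^ c * (schneiderSeq p a 1 b₀ (k + 1) : ℤ) ^ 2)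
    have hdet := schneiderSeq_det p a b₀ (k + 1)
    have hsq : ((-1 : ℤ) ^ (k + 1 + 1)) ^ 2 = 1 := by rw [← pow_mul, mul_comm, pow_mul]; simp
    have hdet2 : ((p : ℤ) ^ partialSum a (k + 1)) ^ 2
        = (schneiderSeq p a 1 b₀ (k + 1 + 1) * schneiderSeq p a 0 1 (k + 1)
          - schneiderSeq p a 1 b₀ (k + 1) * schneiderSeq p a 0 1 (k + 1 + 1)) ^ 2 := by
      rw [hdet, mul_pow, hsq, one_mul]
    rw [hdet2]
    simp only [schneiderPoly]
    rw [h1, h2, h3]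
    ring
  · have h1 : (schneiderPoly p a b₀ c (k + 1)).coeff 2
        = p ^ a (k + 1) * (schneiderSeq p a 0 1 (k + 1 + 1) * schneiderSeq p a 0 1 k)
          + -(p ^ c * (schneiderSeq p a 0 1 (k + 1) : ℤ) ^ 2) := by
      rw [schneiderPoly, (quadratic_coeffs _ _ _).1]
      simp only [schneiderSeq]
      push_cast
      ring
    have h2 : ‖(-(p ^ c * (schneiderSeq p a 0 1 (k + 1) : ℚ_[p]) ^ 2))‖
        = (p : ℝ) ^ (-(c : ℤ)) := by
      rw [norm_neg, norm_mul, norm_pow, norm_pow, norm_schneiderSeq ha, Padic.norm_p, one_pow,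
        mul_one, inv_pow, zpow_neg, zpow_natCast]
    have h3 : ‖((p : ℚ_[p]) ^ a (k + 1)
        * (schneiderSeq p a 0 1 (k + 1 + 1) * schneiderSeq p a 0 1 k))‖
        < ‖(-(p ^ c * (schneiderSeq p a 0 1 (k + 1) : ℚ_[p]) ^ 2))‖ := by
      rw [h2, norm_mul, norm_pow, Padic.norm_p, inv_pow, ← zpow_natCast, ← zpow_neg]
      have h4 := Padic.norm_int_le_one (p := p)
        (schneiderSeq p a 0 1 (k + 1 + 1) * schneiderSeq p a 0 1 k)
      push_cast at h4
      refine lt_of_le_of_lt (mul_le_of_le_one_right (by positivity) h4) ?_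
      exact zpow_lt_zpow_right₀ hp1 (by omega)
    rw [h1]
    push_cast
    rw [Padic.add_eq_max_of_ne h3.ne, max_eq_right h3.le, h2]

lemma supNorm_schneiderPoly_le {p : ℕ} (hp : 2 ≤ p) {a : ℕ → ℕ} {e : ℕ} (he : 2 ≤ e)
    (he1 : a 1 ≤ e) (ha : ∀ n, 1 ≤ n → a (n + 1) ≤ a n + 5) {b₀ : ℕ} (hb₀ : b₀ ≤ p) (c k : ℕ) :
    (schneiderPoly p a b₀ c (k + 1)).supNorm
      ≤ (p : ℝ) ^ (partialSum a (k + 1) + 6 * (k + 1) + e + c + 3) := by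
  have hpR : (2 : ℝ) ≤ p := by exact_mod_cast hp
  set U : ℝ := (p : ℝ) ^ (partialSum a (k + 1) + 6 * (k + 1) + e) with hU
  have key : ∀ x y : ℕ, x ≤ 1 → y ≤ p → (schneiderSeq p a x y (k + 2) : ℝ) ^ 2 ≤ U ∧
      (schneiderSeq p a x y (k + 1) : ℝ) ^ 2 ≤ U := by
    intro x y hx hy
    have h1 := schneiderSeq_sq_le hp he he1 ha hx hy (k + 1)
    have h2 := (schneiderSeq_sq_le hp he he1 ha hx hy k).trans
      (Nat.pow_le_pow_right (j := partialSum a (k + 1) + 6 * (k + 1) + e) (by omega)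
        (by have := partialSum_succ a k; omega))
    exact ⟨by rw [hU]; exact_mod_cast h1, by rw [hU]; exact_mod_cast h2⟩
  obtain ⟨hq, hq'⟩ := key 0 1 (by omega) (by omega)
  obtain ⟨hr, hr'⟩ := key 1 b₀ le_rfl hb₀
  set q : ℝ := ((schneiderSeq p a 0 1 (k + 2) : ℕ) : ℝ)
  set q' : ℝ := ((schneiderSeq p a 0 1 (k + 1) : ℕ) : ℝ)
  set r : ℝ := ((schneiderSeq p a 1 b₀ (k + 2) : ℕ) : ℝ)
  set r' : ℝ := ((schneiderSeq p a 1 b₀ (k + 1) : ℕ) : ℝ)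
  have hq0 : 0 ≤ q := Nat.cast_nonneg _
  have hq0' : 0 ≤ q' := Nat.cast_nonneg _
  have hr0 : 0 ≤ r := Nat.cast_nonneg _
  have hr0' : 0 ≤ r' := Nat.cast_nonneg _
  have hmul : ∀ x y : ℝ, x ^ 2 ≤ U → y ^ 2 ≤ U → x * y ≤ U := fun x y hx hy => by
    nlinarith [sq_nonneg (x - y)]
  have hpc : (1 : ℝ) ≤ (p : ℝ) ^ c := one_le_pow₀ (by linarith)
  have hU0 : 0 < U := by positivity
  have hUU : U ≤ (p : ℝ) ^ c * U := le_mul_of_one_le_left hU0.le hpc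
  have hB : 8 * ((p : ℝ) ^ c * U)
      ≤ (p : ℝ) ^ (partialSum a (k + 1) + 6 * (k + 1) + e + c + 3) := by
    rw [pow_add _ _ 3, pow_add _ _ c, ← hU]
    have h8 : (2 : ℝ) ^ 3 ≤ (p : ℝ) ^ 3 := by gcongr
    nlinarith [mul_pos hU0 (lt_of_lt_of_le one_pos hpc)]
  have hpm : ∀ x y : ℝ, 0 ≤ x * y → x ^ 2 ≤ U → y ^ 2 ≤ U →
      0 ≤ (p : ℝ) ^ c * (x * y) ∧ (p : ℝ) ^ c * (x * y) ≤ (p : ℝ) ^ c * U := fun x y h0 hx hy =>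
    ⟨by positivity, by gcongr; exact hmul x y hx hy⟩
  refine supNorm_quadratic_le ?_ ?_ ?_
  · push_cast
    have h1 := hpm q' q' (mul_nonneg hq0' hq0') hq' hq'
    have h2 := hmul q q' hq hq'
    have h3 := mul_nonneg hq0 hq0'
    have h4 := sq_nonneg q
    change |q ^ 2 - q * q' - (p : ℝ) ^ c * q' ^ 2| ≤ _
    rw [← pow_two] at h1
    rw [abs_le]
    constructor <;> linarith
  · push_cast
    have h1 := hpm q' r' (mul_nonneg hq0' hr0') hq' hr'
    have h2 := hmul q r' hq hr'
    have h3 := mul_nonneg hq0 hr0'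
    have h4 := hmul q' r hq' hr
    have h5 := mul_nonneg hq0' hr0
    have h6 := hmul q r hq hr
    have h7 := mul_nonneg hq0 hr0
    change |q * r' + q' * r - 2 * (q * r) + 2 * ((p : ℝ) ^ c * (q' * r'))| ≤ _
    rw [abs_le]
    constructor <;> linarith
  · push_cast
    have h1 := hpm r' r' (mul_nonneg hr0' hr0') hr' hr'
    have h2 := hmul r r' hr hr'
    have h3 := mul_nonneg hr0 hr0'
    have h4 := sq_nonneg r
    change |r ^ 2 - r * r' - (p : ℝ) ^ c * r' ^ 2| ≤ _
    rw [← pow_two] at h1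
    rw [abs_le]
    constructor <;> linarith

/-! ### Growth of the partial sums along blocks -/

/-- The sequences of partial quotients which are constant between consecutive integer parts of
powers of `w`. -/
structure IsBlockSequence (w : ℝ) (b : ℕ) (ε a : ℕ → ℕ) : Prop where
  le_base : 7 ≤ w
  pos : 0 < b
  digit : ∀ i, ε i = 0 ∨ ε i = 1
  start : ∀ i : ℕ, a ⌊w ^ i⌋₊ = b + 3 * i + 2
  block : ∀ i n : ℕ, ⌊w ^ i⌋₊ < n → n < ⌊w ^ (i + 1)⌋₊ → a n = b + 3 * i + ε i

namespace IsBlockSequence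

variable {w : ℝ} {b : ℕ} {ε a : ℕ → ℕ}

lemma one_le_pow (h : IsBlockSequence w b ε a) (i : ℕ) : 1 ≤ w ^ i :=
  one_le_pow₀ (by linarith [h.le_base])

lemma mul_floor_le (h : IsBlockSequence w b ε a) (i : ℕ) :
    6 * ⌊w ^ i⌋₊ ≤ ⌊w ^ (i + 1)⌋₊ := by
  have h1 := h.one_le_pow i
  have h2 := Nat.floor_le (show 0 ≤ w ^ i by linarith)
  apply Nat.le_floor
  push_cast
  rw [pow_succ]
  nlinarith [h.le_base]

lemma one_le_floor (h : IsBlockSequence w b ε a) (i : ℕ) : 1 ≤ ⌊w ^ i⌋₊ :=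
  Nat.le_floor (by simpa using h.one_le_pow i)

lemma lt_floor (h : IsBlockSequence w b ε a) (i : ℕ) : i < ⌊w ^ i⌋₊ := by
  induction i with
  | zero => simp
  | succ i ih => have := h.mul_floor_le i; omega

lemma exists_block (h : IsBlockSequence w b ε a) {n : ℕ} (hn : 1 ≤ n) :
    ∃ i, ⌊w ^ i⌋₊ ≤ n ∧ n < ⌊w ^ (i + 1)⌋₊ := by
  induction n, hn using Nat.le_induction with
  | base => exact ⟨0, by simp, by have := h.mul_floor_le 0; simp at this ⊢; omega⟩
  | succ n hn ih =>
    obtain ⟨i, h1, h2⟩ := ih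
    rcases Nat.lt_or_ge (n + 1) ⌊w ^ (i + 1)⌋₊ with h3 | h3
    · exact ⟨i, by omega, h3⟩
    · exact ⟨i + 1, h3, by have := h.mul_floor_le (i + 1); omega⟩

lemma bounds (h : IsBlockSequence w b ε a) {i n : ℕ} (h1 : ⌊w ^ i⌋₊ ≤ n)
    (h2 : n < ⌊w ^ (i + 1)⌋₊) : b + 3 * i ≤ a n ∧ a n ≤ b + 3 * i + 2 := by
  rcases h1.eq_or_lt with h3 | h3
  · rw [← h3, h.start]; omega
  · rw [h.block i n h3 h2]
    rcases h.digit i with h4 | h4 <;> rw [h4] <;> omega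

lemma one_le (h : IsBlockSequence w b ε a) (n : ℕ) (hn : 1 ≤ n) : 1 ≤ a n := by
  obtain ⟨i, h1, h2⟩ := h.exists_block hn
  have := (h.bounds h1 h2).1
  have := h.pos
  omega

lemma succ_le (h : IsBlockSequence w b ε a) (n : ℕ) (hn : 1 ≤ n) : a (n + 1) ≤ a n + 5 := by
  obtain ⟨i, h1, h2⟩ := h.exists_block hn
  have h3 := h.bounds h1 h2
  rcases Nat.lt_or_ge (n + 1) ⌊w ^ (i + 1)⌋₊ with h4 | h4
  · have := h.bounds (show ⌊w ^ i⌋₊ ≤ n + 1 by omega) h4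
    omega
  · have h5 : n + 1 = ⌊w ^ (i + 1)⌋₊ := by omega
    rw [h5, h.start]
    omega

/-- The sum of the partial quotients up to the start of the block `j`. -/
def height (_ : IsBlockSequence w b ε a) (j : ℕ) : ℕ := partialSum a ⌊w ^ j⌋₊

lemma partialSum_add_of_const {c : ℕ} (k l : ℕ) (hc : ∀ n, k < n → n ≤ k + l → a n = c) :
    partialSum a (k + l) = partialSum a k + c * l := by
  induction l with
  | zero => simp
  | succ l ih =>
    rw [← add_assoc, partialSum_succ, ih (fun n h1 h2 => hc n h1 (by omega)),
      hc (k + l + 1) (by omega) (by omega)]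
    ring

lemma height_succ (h : IsBlockSequence w b ε a) (j : ℕ) :
    h.height (j + 1) + ε j
      = h.height j + (b + 3 * j + ε j) * (⌊w ^ (j + 1)⌋₊ - ⌊w ^ j⌋₊) + 5 := by
  have h1 := h.mul_floor_le j
  have h2 := h.one_le_floor j
  obtain ⟨l, hl⟩ : ∃ l, ⌊w ^ (j + 1)⌋₊ = ⌊w ^ j⌋₊ + l + 1 :=
    ⟨⌊w ^ (j + 1)⌋₊ - ⌊w ^ j⌋₊ - 1, by omega⟩
  have h3 : partialSum a (⌊w ^ j⌋₊ + l) = partialSum a ⌊w ^ j⌋₊ + (b + 3 * j + ε j) * l :=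
    partialSum_add_of_const _ _ fun n h4 h5 => h.block j n h4 (by omega)
  have h6 := partialSum_succ a (⌊w ^ j⌋₊ + l)
  have h7 := h.start (j + 1)
  rw [hl] at h7
  rw [h3, h7] at h6
  unfold height
  rw [hl, h6, show ⌊w ^ j⌋₊ + l + 1 - ⌊w ^ j⌋₊ = l + 1 by omega]
  ring

/-- The last block dominates: the error inherited from earlier blocks is at most `18 ⌊w ^ j⌋₊ ≤ 3 ⌊w
^ (j + 1)⌋₊`, and the new block adds only a bounded multiple of its length, so `18` is never
exceeded. -/
lemma abs_height_sub_le (h : IsBlockSequence w b ε a) (j : ℕ) :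
    |(h.height j : ℝ) - (b + 3 * j) * ⌊w ^ j⌋₊| ≤ 18 * ⌊w ^ j⌋₊ := by
  induction j with
  | zero =>
    have h1 : h.height 0 = b + 2 := by
      have := h.start 0
      simp only [pow_zero, Nat.floor_one] at this
      simp [height, partialSum, this]
    rw [h1]
    norm_num
  | succ j ih =>
    have h1 := h.height_succ j
    have h2 := h.mul_floor_le j
    have h3 := h.one_le_floor j
    have h4 : ε j ≤ 1 := by rcases h.digit j with h | h <;> omega
    set x := ⌊w ^ j⌋₊
    set y := ⌊w ^ (j + 1)⌋₊
    obtain ⟨z, hz⟩ : ∃ z, y = x + z := ⟨y - x, by omega⟩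
    rw [hz, Nat.add_sub_cancel_left] at h1
    rw [hz] at h2
    have h1' : (h.height (j + 1) : ℝ) + ε j = h.height j + (b + 3 * j + ε j) * z + 5 := by
      exact_mod_cast h1
    have h2' : 6 * (x : ℝ) ≤ x + z := by exact_mod_cast h2
    have h3' : (1 : ℝ) ≤ x := by exact_mod_cast h3
    have h4' : (ε j : ℝ) ≤ 1 := by exact_mod_cast h4
    have h5' : (0 : ℝ) ≤ ε j := Nat.cast_nonneg _
    have h6 : (ε j : ℝ) * z ≤ 1 * z := by gcongr
    have h7 : 0 ≤ (ε j : ℝ) * z := by positivity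
    rw [hz]
    push_cast
    have h8 : (h.height (j + 1) : ℝ) - (b + 3 * (j + 1)) * (x + z)
        = (h.height j - (b + 3 * j) * x) + (ε j * z - ε j + 5 - 3 * (x + z)) := by
      linear_combination h1'
    rw [h8]
    rw [abs_le] at ih ⊢
    constructor <;> nlinarith

end IsBlockSequence

namespace IsBlockSequence

variable {w : ℝ} {b : ℕ} {ε a : ℕ → ℕ}

lemma tendsto_floor_ratio (h : IsBlockSequence w b ε a) :
    Tendsto (fun j => (⌊w ^ (j + 1)⌋₊ : ℝ) / ⌊w ^ j⌋₊) atTop (𝓝 w) := by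
  have hw := h.le_base
  have h1 : Tendsto (fun j : ℕ => (⌊w ^ j⌋₊ : ℝ) / w ^ j) atTop (𝓝 1) :=
    (tendsto_nat_floor_div_atTop (R := ℝ)).comp
      (tendsto_pow_atTop_atTop_of_one_lt (show 1 < w by linarith))
  have h2 := ((((tendsto_add_atTop_iff_nat 1).mpr h1).div h1 one_ne_zero).mul_const w)
  rw [div_one, one_mul] at h2
  refine h2.congr fun j => ?_
  have h3 : (0 : ℝ) < ⌊w ^ j⌋₊ := by exact_mod_cast h.one_le_floor j
  have h4 := h.one_le_pow j
  simp only [Pi.div_apply]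
  rw [pow_succ]
  field_simp

/-- The average of the partial quotients up to the start of the block `j`. -/
def average (h : IsBlockSequence w b ε a) (j : ℕ) : ℝ := (h.height j : ℝ) / ⌊w ^ j⌋₊

lemma abs_average_sub_le (h : IsBlockSequence w b ε a) (j : ℕ) :
    |h.average j - (b + 3 * j)| ≤ 18 := by
  have h3 : (0 : ℝ) < ⌊w ^ j⌋₊ := by exact_mod_cast h.one_le_floor j
  have h1 := h.abs_height_sub_le j
  have h2 : h.average j - (b + 3 * j) = (h.height j - (b + 3 * j) * ⌊w ^ j⌋₊) / ⌊w ^ j⌋₊ := by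
    rw [average]; field_simp
  rwa [h2, abs_div, abs_of_pos h3, div_le_iff₀ h3]

lemma tendsto_average (h : IsBlockSequence w b ε a) : Tendsto h.average atTop atTop := by
  refine tendsto_atTop_mono (f := fun j : ℕ => (j : ℝ) - 18) (fun j => ?_)
    (tendsto_atTop_add_const_right _ _ tendsto_natCast_atTop_atTop)
  have := (abs_le.mp (h.abs_average_sub_le j)).1
  have h1 : (0 : ℝ) ≤ j := Nat.cast_nonneg _
  have h2 : (0 : ℝ) ≤ b := Nat.cast_nonneg _
  linarith

lemma tendsto_average_ratio (h : IsBlockSequence w b ε a) :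
    Tendsto (fun j => h.average (j + 1) / h.average j) atTop (𝓝 1) := by
  have h1 : Tendsto (fun j => (h.average (j + 1) - h.average j) / h.average j) atTop (𝓝 0) := by
    -- Consecutive averages differ by at most `3 + 18 + 18`.
    refine squeeze_zero_norm' (a := fun j => 39 / h.average j) ?_ (h.tendsto_average.const_div_atTop 39)
    filter_upwards [h.tendsto_average.eventually_gt_atTop 0] with j hj
    rw [norm_div, Real.norm_eq_abs, Real.norm_eq_abs, abs_of_pos hj]
    gcongr
    have h2 := abs_le.mp (h.abs_average_sub_le j)
    have h3 := abs_le.mp (h.abs_average_sub_le (j + 1))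
    push_cast at h3
    rw [abs_le]
    constructor <;> linarith
  have h2 := h1.add_const 1
  rw [zero_add] at h2
  refine h2.congr' ?_
  filter_upwards [h.tendsto_average.eventually_gt_atTop 0] with j hj
  field_simp
  ring

lemma average_mul_floor (h : IsBlockSequence w b ε a) (j : ℕ) :
    h.average j * ⌊w ^ j⌋₊ = h.height j := by
  have h3 : (0 : ℝ) < ⌊w ^ j⌋₊ := by exact_mod_cast h.one_le_floor j
  rw [average]; field_simp

lemma tendsto_height_ratio (h : IsBlockSequence w b ε a) :
    Tendsto (fun j => (h.height (j + 1) : ℝ) / h.height j) atTop (𝓝 w) := by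
  have h1 := h.tendsto_average_ratio.mul h.tendsto_floor_ratio
  rw [one_mul] at h1
  refine h1.congr fun j => ?_
  rw [← h.average_mul_floor, ← h.average_mul_floor, mul_div_mul_comm]

/-- This makes the loss `6 * k` in the height bound negligible; it holds because the partial
quotients are unbounded on average. -/
lemma tendsto_floor_div_height (h : IsBlockSequence w b ε a) :
    Tendsto (fun j => (⌊w ^ j⌋₊ : ℝ) / h.height j) atTop (𝓝 0) := by
  refine (h.tendsto_average.const_div_atTop 1).congr fun j => ?_
  rw [average, one_div_div]

lemma tendsto_height (h : IsBlockSequence w b ε a) :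
    Tendsto (fun j => (h.height j : ℝ)) atTop atTop := by
  refine tendsto_atTop_mono (f := fun j : ℕ => (j : ℝ)) (fun j => ?_) tendsto_natCast_atTop_atTop
  have h1 := self_le_partialSum h.one_le ⌊w ^ j⌋₊
  have h2 := h.lt_floor j
  have h3 : j ≤ h.height j := by unfold height; omega
  exact_mod_cast h3

lemma tendsto_quotient_div_height (h : IsBlockSequence w b ε a) :
    Tendsto (fun j => ((b + 3 * j + ε j : ℕ) : ℝ) / h.height j) atTop (𝓝 0) := by
  have h1 := h.tendsto_floor_div_height.const_mul (b + 4 : ℝ)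
  rw [mul_zero] at h1
  refine squeeze_zero (fun j => by positivity) (fun j => ?_) h1
  rw [← mul_div_assoc]
  gcongr
  have h2 := h.lt_floor j
  have h4 : ε j ≤ 1 := by rcases h.digit j with h | h <;> omega
  have h5 : b + 3 * j + ε j ≤ (b + 4) * ⌊w ^ j⌋₊ := by nlinarith
  exact_mod_cast h5

end IsBlockSequence

/-! ### The approximating sequence of quadratics -/

/-- A sequence of quadratic polynomials of heights about `p ^ s j` whose values at `ξ` have absolute
values about `p ^ (-(1 + w) s j)`, where `s (j + 1)` is about `w s j`. -/
structure IsApproxSequence {p : ℕ} [Fact p.Prime] (ξ : ℚ_[p]) (w : ℝ) (F : ℕ → ℤ[X])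
    (e s u v : ℕ → ℕ) : Prop where
  norm_le_one : ‖ξ‖ ≤ 1
  quad : ∀ j, IsSchneiderQuadratic p (e j) (s j) (F j)
  norm_eq : ∀ j, ‖aeval ξ (F j)‖ = (p : ℝ) ^ (-(v j : ℝ))
  supNorm_le : ∀ j, (F j).supNorm ≤ (p : ℝ) ^ (u j : ℝ)
  two_le : ∀ᶠ j in atTop, 2 ≤ e j
  tendsto_s : Tendsto (fun j => (s j : ℝ)) atTop atTop
  tendsto_e : Tendsto (fun j => (e j : ℝ) / s j) atTop (𝓝 0)
  tendsto_u : Tendsto (fun j => (u j : ℝ) / s j) atTop (𝓝 1)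
  tendsto_v : Tendsto (fun j => (v j : ℝ) / s j) atTop (𝓝 (1 + w))
  tendsto_ratio : Tendsto (fun j => (s (j + 1) : ℝ) / s j) atTop (𝓝 w)

lemma IsBlockSequence.exists_isApproxSequence {p : ℕ} [Fact p.Prime] {w : ℝ} {b : ℕ}
    {ε a : ℕ → ℕ} (h : IsBlockSequence w b ε a) {b₀ : ℕ} (hb₀ : b₀ ≤ p) {ξ : ℚ_[p]}
    (hξ : IsSchneiderValue b₀ a ξ) : ∃ (F : ℕ → ℤ[X]) (e s u v : ℕ → ℕ),
      IsApproxSequence ξ w F e s u v := by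
  have hcst : ∀ x : ℝ, Tendsto (fun j => x / h.height j) atTop (𝓝 0) := fun x =>
    h.tendsto_height.const_div_atTop x
  have hself : Tendsto (fun j => (h.height j : ℝ) / h.height j) atTop (𝓝 1) := by
    refine tendsto_const_nhds.congr' ?_
    filter_upwards [h.tendsto_height.eventually_gt_atTop 0] with j hj
    rw [div_self hj.ne']
  refine ⟨fun j => schneiderPoly p a b₀ (b + 3 * j + ε j) ⌊w ^ j⌋₊,
    fun j => b + 3 * j + ε j, h.height,
    fun j => h.height j + 6 * ⌊w ^ j⌋₊ + (b + 2) + (b + 3 * j + ε j) + 3,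
    fun j => 2 * h.height j + (b + 3 * j + ε j) * (⌊w ^ (j + 1)⌋₊ - ⌊w ^ j⌋₊),
    norm_le_one_of_isSchneiderValue h.one_le hξ, fun j => ?_, fun j => ?_, fun j => ?_, ?_,
    h.tendsto_height, h.tendsto_quotient_div_height, ?_, ?_, h.tendsto_height_ratio⟩
  · obtain ⟨k, hk⟩ : ∃ k, ⌊w ^ j⌋₊ = k + 1 := ⟨⌊w ^ j⌋₊ - 1, by have := h.one_le_floor j; omega⟩
    have h1 := h.start j
    unfold IsBlockSequence.height
    rw [hk] at h1 ⊢
    refine isSchneiderQuadratic_schneiderPoly h.one_le b₀ ?_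
    rcases h.digit j with h | h <;> omega
  · have h1 := h.mul_floor_le j
    have h2 := h.one_le_floor j
    obtain ⟨l, hl⟩ : ∃ l, ⌊w ^ (j + 1)⌋₊ = ⌊w ^ j⌋₊ + l + 1 :=
      ⟨⌊w ^ (j + 1)⌋₊ - ⌊w ^ j⌋₊ - 1, by omega⟩
    have h3 := h.start (j + 1)
    rw [hl] at h3
    -- The first partial quotient of the next block is `b + 3 j + 5`, so the constant run really
    -- ends with a larger one.
    have h4 : b + 3 * j + ε j < a (⌊w ^ j⌋₊ + l + 1) := by
      rw [h3]; rcases h.digit j with h | h <;> omega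
    rw [aeval_schneiderPoly, norm_quadForm h.one_le hξ l ⌊w ^ j⌋₊
      (fun n h5 h6 => h.block j n h5 (by omega)) h4, ← Real.rpow_intCast]
    congr 1
    rw [hl, show ⌊w ^ j⌋₊ + l + 1 - ⌊w ^ j⌋₊ = l + 1 by omega, IsBlockSequence.height]
    push_cast
    ring
  · obtain ⟨k, hk⟩ : ∃ k, ⌊w ^ j⌋₊ = k + 1 := ⟨⌊w ^ j⌋₊ - 1, by have := h.one_le_floor j; omega⟩
    have h1 : a 1 ≤ b + 2 := by
      have := h.start 0
      simp only [pow_zero, Nat.floor_one] at this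
      omega
    rw [Real.rpow_natCast]
    unfold IsBlockSequence.height
    rw [hk]
    exact supNorm_schneiderPoly_le (Fact.out : p.Prime).two_le (by omega) h1 h.succ_le hb₀ _ k
  · filter_upwards [eventually_ge_atTop 1] with j hj
    omega
  · have h1 := (((hself.add (h.tendsto_floor_div_height.const_mul 6)).add (hcst (b + 2))).add
      h.tendsto_quotient_div_height).add (hcst 3)
    norm_num at h1
    refine h1.congr fun j => ?_
    push_cast
    ring
  · have h0 : Tendsto (fun j => (5 - ε j : ℝ) / h.height j) atTop (𝓝 0) := by
      refine squeeze_zero (fun j => ?_) (fun j => ?_) (hcst 5)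
      · rcases h.digit j with h | h <;> rw [h] <;> norm_num <;> positivity
      · gcongr
        have : (0 : ℝ) ≤ ε j := Nat.cast_nonneg _
        linarith
    have h1 := (hself.add h.tendsto_height_ratio).sub h0
    rw [sub_zero] at h1
    refine h1.congr fun j => ?_
    -- Thus `v j = s j + s (j + 1) + ε j - 5`, which explains the limit `1 + w`.
    have h2 : (h.height (j + 1) + ε j : ℝ)
        = h.height j + ((b + 3 * j + ε j) * (⌊w ^ (j + 1)⌋₊ - ⌊w ^ j⌋₊) : ℕ) + 5 := by
      exact_mod_cast h.height_succ j
    rw [← add_div, ← sub_div]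
    congr 1
    rw [Nat.cast_add]
    push_cast at h2 ⊢
    linarith

/-! ### Lower bounds for irreducible polynomials and their roots -/

namespace IsApproxSequence

variable {p : ℕ} [Fact p.Prime] {ξ : ℚ_[p]} {w : ℝ} {F : ℕ → ℤ[X]} {e s u v : ℕ → ℕ}

/-- A linear inequality between sequences follows from the strict inequality between the limits of
their quotients by `s`. -/
lemma eventually_le (h : IsApproxSequence ξ w F e s u v) {f g : ℕ → ℝ} {x y : ℝ}
    (hf : Tendsto (fun j => f j / s j) atTop (𝓝 x)) (hg : Tendsto (fun j => g j / s j) atTop (𝓝 y))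
    (hxy : x < y) : ∀ᶠ j in atTop, f j ≤ g j := by
  filter_upwards [hf.eventually_lt hg hxy, h.tendsto_s.eventually_gt_atTop 0] with j h1 h2
  exact ((div_lt_div_iff_of_pos_right h2).mp h1).le

lemma tendsto_self (h : IsApproxSequence ξ w F e s u v) :
    Tendsto (fun j => (s j : ℝ) / s j) atTop (𝓝 1) := by
  refine tendsto_const_nhds.congr' ?_
  filter_upwards [h.tendsto_s.eventually_gt_atTop 0] with j hj
  rw [div_self hj.ne']

lemma tendsto_const (h : IsApproxSequence ξ w F e s u v) (x : ℝ) :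
    Tendsto (fun j => x / s j) atTop (𝓝 0) := h.tendsto_s.const_div_atTop x

lemma tendsto_u_succ (h : IsApproxSequence ξ w F e s u v) :
    Tendsto (fun j => (u (j + 1) : ℝ) / s j) atTop (𝓝 w) := by
  have h1 := ((tendsto_add_atTop_iff_nat 1).mpr h.tendsto_u).mul h.tendsto_ratio
  rw [one_mul] at h1
  refine h1.congr' ?_
  filter_upwards [(((tendsto_add_atTop_iff_nat 1).mpr h.tendsto_s)).eventually_gt_atTop 0] with j hj
  field_simp

lemma tendsto_atTop_of_tendsto_div (h : IsApproxSequence ξ w F e s u v) {f : ℕ → ℝ} {x : ℝ}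
    (hf : Tendsto (fun j => f j / s j) atTop (𝓝 x)) (hx : 0 < x) : Tendsto f atTop atTop := by
  refine (hf.pos_mul_atTop hx h.tendsto_s).congr' ?_
  filter_upwards [h.tendsto_s.eventually_gt_atTop 0] with j hj
  field_simp

/-- Compare `P` with the first `F j`, `j ≥ N`, whose value is too small to satisfy the Liouville
inequality by itself. Minimality bounds `p ^ T (j - 1)` by `K H ^ 2`, and hypothesis `hd` is exactly
what turns this into a bound for `p ^ (d u j)` sharp enough to yield the exponent `w`. -/
lemma exists_lower_bound_of_not_dvd (h : IsApproxSequence ξ w F e s u v) {d : ℕ}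
    (hw : 2 ≤ w) (hd : 2 * (d : ℝ) * w < (w - 2) * (w + 1 - d)) (hdw : (d : ℝ) < w + 1) :
    ∀ᶠ N in atTop, ∃ c : ℝ, 0 < c ∧ ∀ P : ℤ[X], Irreducible P → P.natDegree ≠ 0 →
      P.natDegree ≤ d → (∀ j, N ≤ j → ¬ P ∣ F j) → c * P.supNorm ^ (-w) ≤ ‖aeval ξ P‖ := by
  have hq : (1 : ℝ) < p := by exact_mod_cast (Fact.out : p.Prime).one_lt
  have hq0 : (0 : ℝ) < p := by linarith
  set K : ℝ := (((d + 2).factorial : ℕ) : ℝ) with hK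
  have hK1 : 1 ≤ K := by
    rw [hK]; exact_mod_cast Nat.succ_le_of_lt (Nat.factorial_pos (d + 2))
  -- `F j` is negligible in the Liouville inequality precisely when `K * H ^ 2 < p ^ T j`.
  set T : ℕ → ℝ := fun j => v j - d * u j with hT
  have hTlim : Tendsto (fun j => T j / s j) atTop (𝓝 (1 + w - d)) := by
    have h1 := h.tendsto_v.sub (h.tendsto_u.const_mul (d : ℝ))
    rw [mul_one] at h1
    refine h1.congr fun j => ?_
    simp only [hT]; ring
  have hTtop : Tendsto T atTop atTop := h.tendsto_atTop_of_tendsto_div hTlim (by linarith)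
  have hstep : ∀ᶠ j in atTop, (d : ℝ) * u (j + 1) ≤ (w - 2) / 2 * T j := by
    refine h.eventually_le (x := d * w) (y := (w - 2) / 2 * (1 + w - d)) ?_ ?_ (by linarith)
    · refine (h.tendsto_u_succ.const_mul (d : ℝ)).congr fun j => ?_
      ring
    · refine (hTlim.const_mul ((w - 2) / 2)).congr fun j => ?_
      ring
  filter_upwards [eventually_forall_ge_atTop.mpr hstep] with N hN
  -- The first term serves the case `j = N`, where there is no preceding index to use; the second
  -- serves all `j > N`.
  set c : ℝ := min (K * (p : ℝ) ^ (d * u N : ℝ))⁻¹ (K ^ (w / 2))⁻¹ with hc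
  have hK0 : 0 < K := by linarith
  refine ⟨c, by positivity, fun P hP hPd hPd' hnd => ?_⟩
  have hH := one_le_supNorm hP.ne_zero
  set H := P.supNorm with hHd
  have hH0 : 0 < H := by linarith
  have hex : ∃ j, N ≤ j ∧ K * H ^ 2 < (p : ℝ) ^ T j := by
    have h1 : Tendsto (fun j => (p : ℝ) ^ T j) atTop atTop :=
      (tendsto_rpow_atTop_of_base_gt_one _ hq).comp hTtop
    obtain ⟨j, hj1, hj2⟩ :=
      ((eventually_ge_atTop N).and (h1.eventually_gt_atTop (K * H ^ 2))).exists
    exact ⟨j, hj1, hj2⟩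
  classical
  obtain ⟨hj1, hj2⟩ := Nat.find_spec hex
  have hmin := fun i (hi : i < Nat.find hex) => Nat.find_min hex hi
  set j := Nat.find hex with hj
  have hFs : (F j).supNorm ^ d ≤ (p : ℝ) ^ (d * u j : ℝ) := by
    calc _ ≤ ((p : ℝ) ^ (u j : ℝ)) ^ d := by
          gcongr
          · exact (F j).supNorm_nonneg
          · exact h.supNorm_le j
      _ = _ := by rw [← Real.rpow_natCast, ← Real.rpow_mul hq0.le, mul_comm]
  have hL := one_le_mul_max_of_not_dvd h.norm_le_one hP hPd hPd' (h.quad j).natDegree_le (hnd j hj1)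
  have hL2 : 1 ≤ K * ((p : ℝ) ^ (d * u j : ℝ) * H ^ 2) * max ‖aeval ξ P‖ ‖aeval ξ (F j)‖ := by
    refine hL.trans ?_
    gcongr
  have hmain : 1 ≤ K * ((p : ℝ) ^ (d * u j : ℝ) * H ^ 2) * ‖aeval ξ P‖ := by
    rcases le_total ‖aeval ξ (F j)‖ ‖aeval ξ P‖ with h1 | h1
    · rwa [max_eq_left h1] at hL2
    · exfalso
      rw [max_eq_right h1, h.norm_eq] at hL2
      have h2 : K * ((p : ℝ) ^ (d * u j : ℝ) * H ^ 2) * (p : ℝ) ^ (-(v j : ℝ))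
          = (K * H ^ 2) * (p : ℝ) ^ (-T j) := by
        rw [show -T j = d * u j + -(v j : ℝ) by simp only [hT]; ring, Real.rpow_add hq0]
        ring
      rw [h2, Real.rpow_neg hq0.le, ← div_eq_mul_inv, le_div_iff₀ (by positivity), one_mul] at hL2
      linarith
  have hbound : (p : ℝ) ^ (d * u j : ℝ) * H ^ 2 * K ≤ c⁻¹ * H ^ w := by
    have hHw : H ^ 2 ≤ H ^ w := by
      rw [← Real.rpow_natCast]
      exact Real.rpow_le_rpow_of_exponent_le hH (by simpa using hw)
    rcases hj1.eq_or_lt with h1 | h1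
    · rw [← h1]
      have h2 : K * (p : ℝ) ^ (d * u N : ℝ) ≤ c⁻¹ := by
        rw [le_inv_comm₀ (by positivity) (by positivity)]
        exact min_le_left _ _
      calc _ = (K * (p : ℝ) ^ (d * u N : ℝ)) * H ^ 2 := by ring
        _ ≤ _ := by gcongr
    · obtain ⟨i, hi⟩ : ∃ i, j = i + 1 := ⟨j - 1, by omega⟩
      have h2 : (p : ℝ) ^ T i ≤ K * H ^ 2 := by
        by_contra h3
        exact hmin i (by omega) ⟨by omega, not_le.mp h3⟩
      have h3 : (p : ℝ) ^ (d * u j : ℝ) ≤ (K * H ^ 2) ^ ((w - 2) / 2) := by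
        calc _ ≤ (p : ℝ) ^ (T i * ((w - 2) / 2)) := by
              refine Real.rpow_le_rpow_of_exponent_le hq.le ?_
              rw [hi, mul_comm (T i)]
              exact hN i (by omega)
          _ = ((p : ℝ) ^ T i) ^ ((w - 2) / 2) := Real.rpow_mul hq0.le _ _
          _ ≤ _ := Real.rpow_le_rpow (by positivity) h2 (by linarith)
      have h4 : K ^ (w / 2) ≤ c⁻¹ := by
        rw [le_inv_comm₀ (by positivity) (by positivity)]
        exact min_le_right _ _
      calc _ = (p : ℝ) ^ (d * u j : ℝ) * (K * H ^ 2) := by ring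
        _ ≤ (K * H ^ 2) ^ ((w - 2) / 2) * (K * H ^ 2) := by gcongr
        _ = (K * H ^ 2) ^ (w / 2) := by
          rw [← Real.rpow_add_one (by positivity)]; congr 1; ring
        _ = K ^ (w / 2) * H ^ w := by
          rw [Real.mul_rpow hK0.le (by positivity), ← Real.rpow_natCast H 2,
            ← Real.rpow_mul hH0.le]
          congr 2; push_cast; ring
        _ ≤ _ := by gcongr
  have hc0 : 0 < c := by positivity
  have h5 : 1 ≤ (c⁻¹ * H ^ w) * ‖aeval ξ P‖ := by
    calc _ ≤ _ := hmain
      _ = (p : ℝ) ^ (d * u j : ℝ) * H ^ 2 * K * ‖aeval ξ P‖ := by ring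
      _ ≤ _ := by gcongr
  rw [Real.rpow_neg hH0.le]
  have h6 : 0 < H ^ w := by positivity
  calc c * (H ^ w)⁻¹ = c * (H ^ w)⁻¹ * 1 := by ring
    _ ≤ c * (H ^ w)⁻¹ * ((c⁻¹ * H ^ w) * ‖aeval ξ P‖) := by gcongr
    _ = _ := by field_simp

lemma eventually_lower_bound_of_dvd (h : IsApproxSequence ξ w F e s u v) (hw : 2 ≤ w) {η : ℝ}
    (hη : 0 < η) : ∀ᶠ j in atTop, ∀ P : ℤ[X], Irreducible P → P.natDegree ≠ 0 → P ∣ F j →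
      P.supNorm ^ (-(w + 1 + η)) ≤ ‖aeval ξ P‖ ∧
        ∀ β : ℚ_[p], aeval β P = 0 → P.supNorm ^ (-(w + η)) ≤ ‖ξ - β‖ := by
  have hq : (1 : ℝ) < p := by exact_mod_cast (Fact.out : p.Prime).one_lt
  have hq0 : (0 : ℝ) < p := by linarith
  have hq2 : (2 : ℝ) ≤ p := by exact_mod_cast (Fact.out : p.Prime).two_le
  have hg : Tendsto (fun j => ((s j : ℝ) - e j - 2) / s j) atTop (𝓝 1) := by
    have h1 := (h.tendsto_self.sub h.tendsto_e).sub (h.tendsto_const 2)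
    rw [sub_zero, sub_zero] at h1
    refine h1.congr fun j => ?_
    ring
  have h1 : ∀ᶠ j in atTop, (v j : ℝ) ≤ ((s j : ℝ) - e j - 2) * (w + 1 + η) := by
    refine h.eventually_le h.tendsto_v (y := 1 * (w + 1 + η)) ?_ (by linarith)
    refine (hg.mul_const _).congr fun j => ?_
    ring
  have h2 : ∀ᶠ j in atTop, (v j - s j : ℝ) ≤ ((s j : ℝ) - e j - 2) * (w + η) := by
    refine h.eventually_le (x := 1 + w - 1) (y := 1 * (w + η)) ?_ ?_ (by linarith)
    · refine (h.tendsto_v.sub h.tendsto_self).congr fun j => ?_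
      ring
    · refine (hg.mul_const _).congr fun j => ?_
      ring
  have h3 : ∀ᶠ j in atTop, (2 * s j : ℝ) ≤ v j := by
    refine h.eventually_le (x := 2 * 1) ?_ h.tendsto_v (by linarith)
    refine (h.tendsto_self.const_mul 2).congr fun j => ?_
    ring
  filter_upwards [h1, h2, h3, h.two_le] with j h1 h2 h3 he P hP hPd hdvd
  have hH := one_le_supNorm hP.ne_zero
  -- The `2` in the exponent absorbs the constant `3 ≤ p ^ 2`.
  have hHg : (p : ℝ) ^ ((s j : ℝ) - e j - 2) ≤ P.supNorm := by
    have h4 := (h.quad j).pow_le_mul_supNorm_of_dvd he hPd hdvd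
    have h5 : (3 : ℝ) ≤ (p : ℝ) ^ 2 := by nlinarith
    have h6 : (p : ℝ) ^ s j ≤ (p : ℝ) ^ 2 * p ^ e j * P.supNorm := h4.trans (by gcongr)
    rw [Real.rpow_sub hq0, Real.rpow_sub hq0, Real.rpow_natCast, Real.rpow_natCast,
      show (2 : ℝ) = (2 : ℕ) by norm_num, Real.rpow_natCast, div_div, div_le_iff₀ (by positivity)]
    linarith
  have hpow : ∀ x y : ℝ, 0 ≤ y → x ≤ ((s j : ℝ) - e j - 2) * y →
      P.supNorm ^ (-y) ≤ (p : ℝ) ^ (-x) := by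
    intro x y hy hxy
    calc _ ≤ ((p : ℝ) ^ ((s j : ℝ) - e j - 2)) ^ (-y) :=
          Real.rpow_le_rpow_of_nonpos (by positivity) hHg (by linarith)
      _ = (p : ℝ) ^ (-(((s j : ℝ) - e j - 2) * y)) := by
          rw [← Real.rpow_mul hq0.le, mul_neg]
      _ ≤ _ := Real.rpow_le_rpow_of_exponent_le hq.le (by linarith)
  refine ⟨?_, fun β hβ => ?_⟩
  · refine (hpow _ _ (by linarith) h1).trans ?_
    rw [← h.norm_eq]
    exact (h.quad j).norm_aeval_le_of_dvd he hPd hdvd ξ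
  · refine (hpow _ _ (by linarith) h2).trans ?_
    have hβF : aeval β (F j) = 0 := by
      obtain ⟨Q, hQ⟩ := hdvd
      rw [hQ, map_mul, hβ, zero_mul]
    refine le_trans (le_of_eq ?_) ((h.quad j).le_norm_sub_of_root (by omega) (ξ := ξ) hβF ?_)
    · rw [h.norm_eq, ← Real.rpow_natCast, ← Real.rpow_add hq0]
      congr 1; ring
    · rw [h.norm_eq, ← Real.rpow_intCast, ← Real.rpow_natCast, ← Real.rpow_mul hq0.le]
      refine Real.rpow_le_rpow_of_exponent_le hq.le ?_
      push_cast
      linarith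

/-- When `P` divides no late `F j`, the bound with exponent `w` already controls the roots, since
`|P(ξ)| ≤ |ξ - β|` for integral `ξ` and `β`. When it divides one, the distance bound saves a factor
`p ^ (s j)` over the bound for the value. -/
lemma exists_lower_bound (h : IsApproxSequence ξ w F e s u v) {d : ℕ}
    (hw : 2 ≤ w) (hd : 2 * (d : ℝ) * w < (w - 2) * (w + 1 - d)) (hdw : (d : ℝ) < w + 1) {η : ℝ}
    (hη : 0 < η) : ∃ c : ℝ, 0 < c ∧ ∀ P : ℤ[X], Irreducible P → P.natDegree ≠ 0 →
      P.natDegree ≤ d → c * P.supNorm ^ (-(w + 1 + η)) ≤ ‖aeval ξ P‖ ∧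
        ∀ β : ℚ_[p], ‖β‖ ≤ 1 → aeval β P = 0 → c * P.supNorm ^ (-(w + η)) ≤ ‖ξ - β‖ := by
  obtain ⟨N, ⟨c, hc, hN⟩, hN'⟩ := ((h.exists_lower_bound_of_not_dvd hw hd hdw).and
    (eventually_forall_ge_atTop.mpr (h.eventually_lower_bound_of_dvd hw hη))).exists
  refine ⟨min c 1, by positivity, fun P hP hPd hPd' => ?_⟩
  have hH := one_le_supNorm hP.ne_zero
  have hpos : ∀ x : ℝ, 0 ≤ P.supNorm ^ x := fun x => Real.rpow_nonneg (by linarith) _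
  by_cases hdvd : ∃ j, N ≤ j ∧ P ∣ F j
  · obtain ⟨j, hj, hPj⟩ := hdvd
    obtain ⟨h1, h2⟩ := hN' j hj P hP hPd hPj
    exact ⟨(mul_le_of_le_one_left (hpos _) (min_le_right _ _)).trans h1,
      fun β _ hβ => (mul_le_of_le_one_left (hpos _) (min_le_right _ _)).trans (h2 β hβ)⟩
  · have h1 := hN P hP hPd hPd' fun j hj hPj => hdvd ⟨j, hj, hPj⟩
    have h2 : ∀ x, w ≤ x → min c 1 * P.supNorm ^ (-x) ≤ ‖aeval ξ P‖ := by
      intro x hx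
      refine le_trans ?_ h1
      have h3 : P.supNorm ^ (-x) ≤ P.supNorm ^ (-w) :=
        Real.rpow_le_rpow_of_exponent_le hH (by linarith)
      have := hpos (-x)
      gcongr
      exact min_le_left _ _
    refine ⟨h2 _ (by linarith), fun β hβ1 hβ => (h2 _ (by linarith)).trans ?_⟩
    have h3 := norm_aeval_sub_aeval_le h.norm_le_one hβ1 P
    rwa [hβ, sub_zero] at h3

end IsApproxSequence

/-! ### Computation of the exponents -/

lemma le_of_mul_rpow_neg_le {c H x y : ℝ} (hc : 0 < c) (hH : 1 ≤ H) (hxy : x < y)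
    (h : c * H ^ (-x) ≤ H ^ (-y)) : H ≤ (c⁻¹) ^ (1 / (y - x)) := by
  have hH0 : 0 < H := by linarith
  have hd : 0 < y - x := by linarith
  have h1 : H ^ (y - x) ≤ c⁻¹ := by
    rw [le_inv_comm₀ (by positivity) hc, ← Real.rpow_neg hH0.le]
    have h2 : H ^ (-(y - x)) = H ^ (-y) * H ^ x := by
      rw [← Real.rpow_add hH0]; congr 1; ring
    have h3 : c = c * H ^ (-x) * H ^ x := by
      rw [mul_assoc, ← Real.rpow_add hH0]; simp
    rw [h2, h3]
    gcongr
  calc H = (H ^ (y - x)) ^ (1 / (y - x)) := by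
        rw [← Real.rpow_mul hH0.le, mul_one_div_cancel hd.ne', Real.rpow_one]
    _ ≤ _ := Real.rpow_le_rpow (by positivity) h1 (by positivity)

lemma infinite_of_forall_exists_lt {X : Type*} {S : Set X} (g : X → ℝ) (hg : ∀ x ∈ S, 0 < g x)
    (h : ∀ δ : ℝ, 0 < δ → ∃ x ∈ S, g x < δ) : S.Infinite := by
  intro hfin
  obtain ⟨x₀, hx₀, -⟩ := h 1 one_pos
  obtain ⟨y, hy, hmin⟩ := S.exists_min_image g hfin ⟨x₀, hx₀⟩
  obtain ⟨x, hx, hlt⟩ := h (g y) (hg y hy)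
  exact absurd (hmin x hx) (not_le.mpr hlt)

namespace IsApproxSequence

variable {p : ℕ} [Fact p.Prime] {ξ : ℚ_[p]} {w : ℝ} {F : ℕ → ℤ[X]} {e s u v : ℕ → ℕ}

lemma exponentW_le (h : IsApproxSequence ξ w F e s u v) {d n : ℕ} (hn : n ≤ d)
    (hw : 2 ≤ w) (hd : 2 * (d : ℝ) * w < (w - 2) * (w + 1 - d)) (hdw : (d : ℝ) < w + 1) :
    exponentW n ξ ≤ (w : EReal) := by
  refine sSup_le ?_
  rintro _ ⟨w', rfl, hinf⟩
  rw [EReal.coe_le_coe_iff]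
  by_contra hlt
  rw [not_le] at hlt
  -- Half of the excess `w' - w` is spent on `η`; the other half bounds the height.
  obtain ⟨c, hc, hlow⟩ := h.exists_lower_bound hw hd hdw (η := (w' - w) / 2) (by linarith)
  obtain ⟨c', hc', hlow'⟩ := exists_lower_bound_of_irreducible hc (by linarith)
    fun P h1 h2 h3 => (hlow P h1 h2 h3).1
  refine hinf ((finite_natDegree_le_supNorm_le d
    ((c'⁻¹) ^ (1 / ((w' + 1) - (w + 1 + (w' - w) / 2))))).subset ?_)
  rintro P ⟨hPn, hP0, hP⟩
  have hPne : P ≠ 0 := by rintro rfl; simp at hP0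
  refine ⟨hPn.trans hn, le_of_mul_rpow_neg_le hc' (one_le_supNorm hPne) (by linarith) ?_⟩
  refine (hlow' P hPne (hPn.trans hn)).trans (hP.trans (le_of_eq ?_))
  congr 1; ring

lemma exponentWStar_le (h : IsApproxSequence ξ w F e s u v) {d n : ℕ} (hn : n ≤ d)
    (hw : 2 ≤ w) (hd : 2 * (d : ℝ) * w < (w - 2) * (w + 1 - d)) (hdw : (d : ℝ) < w + 1) :
    exponentWStar n ξ ≤ ((w - 1 : ℝ) : EReal) := by
  refine sSup_le ?_
  rintro _ ⟨w', rfl, hinf⟩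
  rw [EReal.coe_le_coe_iff]
  by_contra hlt
  rw [not_le] at hlt
  obtain ⟨c, hc, hlow⟩ := h.exists_lower_bound hw hd hdw (η := (w' - (w - 1)) / 2) (by linarith)
  set B : ℝ := (c⁻¹) ^ (1 / ((w' + 1) - (w + (w' - (w - 1)) / 2))) with hB
  have hroots : (⋃ P ∈ {P : ℤ[X] | P.natDegree ≤ d ∧ P.supNorm ≤ B},
      P.rootSet ℚ_[p]).Finite :=
    (finite_natDegree_le_supNorm_le d B).biUnion fun P _ => P.rootSet_finite _
  refine hinf (hroots.subset ?_)
  rintro α ⟨hα, hαn, hα0, hle⟩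
  have hirr := irreducible_intMinpoly hα
  have hdeg : (intMinpoly α).natDegree ≤ d := by
    rw [natDegree_intMinpoly hα]; exact hαn.trans hn
  have hH := one_le_supNorm hirr.ne_zero
  have hroot := aeval_intMinpoly hα
  -- The exponent `-w' - 1` is negative and the height at least `1`, so `α` is within distance `1`
  -- of `ξ` and hence integral.
  have hα1 : ‖α‖ ≤ 1 := by
    have h1 : ‖ξ - α‖ ≤ 1 := by
      refine hle.trans (Real.rpow_le_one_of_one_le_of_nonpos hH (by linarith))
    have h2 : α = ξ + -(ξ - α) := by ring
    rw [h2]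
    exact (Padic.nonarchimedean _ _).trans (max_le h.norm_le_one (by rwa [norm_neg]))
  have hl := (hlow _ hirr (natDegree_intMinpoly_ne_zero hα) hdeg).2 α hα1 hroot
  rw [Set.mem_iUnion₂]
  refine ⟨intMinpoly α, ⟨hdeg, ?_⟩, ?_⟩
  · refine le_of_mul_rpow_neg_le hc hH (by linarith) (hl.trans (hle.trans (le_of_eq ?_)))
    rw [algHeight]
    congr 1; ring
  · rw [mem_rootSet]
    exact ⟨hirr.ne_zero, hroot⟩

lemma le_exponentW (h : IsApproxSequence ξ w F e s u v) {n : ℕ} (hn : 2 ≤ n) (hw : 2 ≤ w) :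
    (w : EReal) ≤ exponentW n ξ := by
  have hq : (1 : ℝ) < p := by exact_mod_cast (Fact.out : p.Prime).one_lt
  have hq0 : (0 : ℝ) < p := by linarith
  have key : ∀ w' : ℝ, 0 ≤ w' → w' < w → (w' : EReal) ≤ exponentW n ξ := by
    intro w' h0 hlt
    refine le_sSup ⟨w', rfl, infinite_of_forall_exists_lt (fun P => ‖aeval ξ P‖)
      (fun P hP => hP.2.1) fun δ hδ => ?_⟩
    have h1 : ∀ᶠ j in atTop, (u j : ℝ) * (w' + 1) ≤ v j := by
      refine h.eventually_le (x := 1 * (w' + 1)) ?_ h.tendsto_v (by linarith)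
      refine (h.tendsto_u.mul_const _).congr fun j => ?_
      ring
    have h2 : Tendsto (fun j => (p : ℝ) ^ (-(v j : ℝ))) atTop (𝓝 0) :=
      (tendsto_rpow_atBot_of_base_gt_one _ hq).comp (tendsto_neg_atTop_atBot.comp
        (h.tendsto_atTop_of_tendsto_div h.tendsto_v (by linarith)))
    obtain ⟨j, hj1, hj2⟩ := (h1.and (h2.eventually_lt_const hδ)).exists
    refine ⟨F j, ⟨(h.quad j).natDegree_le.trans hn, ?_, ?_⟩, ?_⟩
    · rw [h.norm_eq]; positivity
    · have hH := one_le_supNorm (h.quad j).ne_zero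
      rw [h.norm_eq]
      calc (p : ℝ) ^ (-(v j : ℝ)) ≤ (p : ℝ) ^ ((u j : ℝ) * (-w' - 1)) :=
            Real.rpow_le_rpow_of_exponent_le hq.le (by linarith)
        _ = ((p : ℝ) ^ (u j : ℝ)) ^ (-w' - 1) := Real.rpow_mul hq0.le _ _
        _ ≤ _ := Real.rpow_le_rpow_of_nonpos (by linarith) (h.supNorm_le j) (by linarith)
    · simp only [h.norm_eq]; exact hj2
  refine le_of_forall_lt fun x hx => ?_
  induction x with
  | bot => exact lt_of_lt_of_le (EReal.bot_lt_coe 0) (key 0 le_rfl (by linarith))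
  | top => exact absurd hx (by simp)
  | coe x =>
    rw [EReal.coe_lt_coe_iff] at hx
    obtain ⟨y, hy1, hy2⟩ := exists_between (max_lt hx (show (0 : ℝ) < w by linarith))
    refine lt_of_lt_of_le ?_ (key y ((le_max_right _ _).trans hy1.le) hy2)
    exact EReal.coe_lt_coe_iff.mpr ((le_max_left _ _).trans_lt hy1)

lemma supNorm_le_of_dvd_of_isSchneiderQuadratic {e s : ℕ} {F P : ℤ[X]}
    (hF : IsSchneiderQuadratic p e s F) (he : 2 ≤ e) (hd : P.natDegree ≠ 0) (h : P ∣ F) :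
    P.supNorm ≤ F.supNorm := by
  obtain ⟨k, hk0, hk, -⟩ := hF.exists_eq_C_mul he hd h
  refine supNorm_le_of_coeff_le fun i => ?_
  have h1 := abs_coeff_le_supNorm F i
  have h2 : (1 : ℝ) ≤ |(k : ℝ)| := by exact_mod_cast Int.one_le_abs hk0
  refine le_trans ?_ h1
  rw [hk, coeff_C_mul, Int.cast_mul, abs_mul]
  exact le_mul_of_one_le_left (abs_nonneg _) h2

lemma le_exponentWStar (h : IsApproxSequence ξ w F e s u v) {n : ℕ} (hn : 2 ≤ n) (hw : 2 ≤ w) :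
    ((w - 1 : ℝ) : EReal) ≤ exponentWStar n ξ := by
  have hq : (1 : ℝ) < p := by exact_mod_cast (Fact.out : p.Prime).one_lt
  have hq0 : (0 : ℝ) < p := by linarith
  have hvs : Tendsto (fun j => (v j - s j : ℝ) / s j) atTop (𝓝 (1 + w - 1)) := by
    refine (h.tendsto_v.sub h.tendsto_self).congr fun j => ?_
    ring
  have key : ∀ w' : ℝ, 0 ≤ w' → w' < w - 1 → (w' : EReal) ≤ exponentWStar n ξ := by
    intro w' h0 hlt
    refine le_sSup ⟨w', rfl, infinite_of_forall_exists_lt (fun α => ‖ξ - α‖)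
      (fun α hα => hα.2.2.1) fun δ hδ => ?_⟩
    have h1 : ∀ᶠ j in atTop, (u j : ℝ) * (w' + 1) ≤ v j - s j := by
      refine h.eventually_le (x := 1 * (w' + 1)) ?_ hvs (by linarith)
      refine (h.tendsto_u.mul_const _).congr fun j => ?_
      ring
    have h2 : Tendsto (fun j => (p : ℝ) ^ (-(v j - s j : ℝ))) atTop (𝓝 0) :=
      (tendsto_rpow_atBot_of_base_gt_one _ hq).comp (tendsto_neg_atTop_atBot.comp
        (h.tendsto_atTop_of_tendsto_div hvs (by linarith)))
    -- The extra `1` gives the strict inequality required by Hensel's lemma.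
    have h3 : ∀ᶠ j in atTop, (2 * s j + 1 : ℝ) ≤ v j := by
      refine h.eventually_le (x := 2 * 1 + 0) ?_ h.tendsto_v (by linarith)
      refine ((h.tendsto_self.const_mul 2).add (h.tendsto_const 1)).congr fun j => ?_
      ring
    obtain ⟨j, ⟨⟨hj1, hj2⟩, hj3⟩, he⟩ :=
      (((h1.and (h2.eventually_lt_const hδ)).and h3).and h.two_le).exists
    obtain ⟨α, hα, hle⟩ := (h.quad j).exists_root (by omega) h.norm_le_one (by
      rw [h.norm_eq, ← Real.rpow_intCast, ← Real.rpow_natCast, ← Real.rpow_mul hq0.le]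
      refine Real.rpow_lt_rpow_of_exponent_lt hq ?_
      push_cast
      linarith)
    have hle' : ‖ξ - α‖ ≤ (p : ℝ) ^ (-(v j - s j : ℝ)) := by
      refine hle.trans (le_of_eq ?_)
      rw [h.norm_eq, ← Real.rpow_natCast, ← Real.rpow_add hq0]
      congr 1; ring
    have halg : IsAlgebraic ℚ α := by
      have : IsAlgebraic ℤ α := ⟨F j, (h.quad j).ne_zero, hα⟩
      exact this.extendScalars (algebraMap ℤ ℚ).injective_int
    have hdvd := intMinpoly_dvd halg hα
    have hirr := irreducible_intMinpoly halg
    have hdeg := natDegree_intMinpoly_ne_zero halg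
    have hH := one_le_supNorm hirr.ne_zero
    have hHF := (supNorm_le_of_dvd_of_isSchneiderQuadratic (h.quad j) he hdeg hdvd).trans
      (h.supNorm_le j)
    refine ⟨α, ⟨halg, ?_, ?_, ?_⟩, hle'.trans_lt hj2⟩
    · rw [← natDegree_intMinpoly halg]
      exact (natDegree_le_of_dvd hdvd (h.quad j).ne_zero).trans
        ((h.quad j).natDegree_le.trans hn)
    · rw [norm_pos_iff, sub_ne_zero]
      rintro rfl
      have h4 := h.norm_eq j
      rw [hα, norm_zero] at h4
      exact (Real.rpow_pos_of_pos hq0 _).ne h4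
    · calc ‖ξ - α‖ ≤ (p : ℝ) ^ (-(v j - s j : ℝ)) := hle'
        _ ≤ (p : ℝ) ^ ((u j : ℝ) * (-w' - 1)) :=
            Real.rpow_le_rpow_of_exponent_le hq.le (by linarith)
        _ = ((p : ℝ) ^ (u j : ℝ)) ^ (-w' - 1) := Real.rpow_mul hq0.le _ _
        _ ≤ _ := Real.rpow_le_rpow_of_nonpos (lt_of_lt_of_le one_pos hH) hHF (by linarith)
  refine le_of_forall_lt fun x hx => ?_
  induction x with
  | bot => exact lt_of_lt_of_le (EReal.bot_lt_coe 0) (key 0 le_rfl (by linarith))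
  | top => exact absurd hx (by simp)
  | coe x =>
    rw [EReal.coe_lt_coe_iff] at hx
    obtain ⟨y, hy1, hy2⟩ := exists_between (max_lt hx (show (0 : ℝ) < w - 1 by linarith))
    refine lt_of_lt_of_le ?_ (key y ((le_max_right _ _).trans hy1.le) hy2)
    exact EReal.coe_lt_coe_iff.mpr ((le_max_left _ _).trans_lt hy1)

end IsApproxSequence

end

theorem mainTheorem11 (p : ℕ) [Fact p.Prime] (d : ℕ) (hd : 2 ≤ d) (w : ℝ)
    (hw : (3 * (d : ℝ) + 2 + Real.sqrt (9 * (d : ℝ) ^ 2 + 4 * (d : ℝ) + 4)) / 2 ≤ w)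
    (b : ℕ) (hb : 0 < b) (ε : ℕ → ℕ) (hε : ∀ i, ε i = 0 ∨ ε i = 1)
    (a : ℕ → ℕ)
    (ha₁ : ∀ i : ℕ, a ⌊w ^ i⌋₊ = b + 3 * i + 2)
    (ha₂ : ∀ i n : ℕ, ⌊w ^ i⌋₊ < n → n < ⌊w ^ (i + 1)⌋₊ → a n = b + 3 * i + ε i)
    (b₀ : ℕ) (hb₀ : b₀ < p) :
    ∃ ξ : ℚ_[p], IsSchneiderValue b₀ a ξ ∧
      ∀ n : ℕ, 2 ≤ n → n ≤ d →
        exponentWStar n ξ = ((w - 1 : ℝ) : EReal) ∧ exponentW n ξ = ((w : ℝ) : EReal) := by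
  have hd' : (2 : ℝ) ≤ d := by exact_mod_cast hd
  set r := Real.sqrt (9 * (d : ℝ) ^ 2 + 4 * (d : ℝ) + 4) with hr
  have hr2 : r ^ 2 = 9 * (d : ℝ) ^ 2 + 4 * (d : ℝ) + 4 := Real.sq_sqrt (by positivity)
  have hr3 : 3 * (d : ℝ) ≤ r := Real.le_sqrt_of_sq_le (by nlinarith)
  have hw3 : 3 * (d : ℝ) + 1 ≤ w := by linarith
  -- The bound assumed on `w` is the larger root of this quadratic.
  have hwd : 0 ≤ w ^ 2 - (3 * d + 2) * w + 2 * d := by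
    nlinarith [mul_nonneg (show 0 ≤ w - (3 * d + 2 + r) / 2 by linarith)
      (show 0 ≤ w - (3 * d + 2 - r) / 2 by linarith)]
  have hblock : IsBlockSequence w b ε a := ⟨by linarith, hb, hε, ha₁, ha₂⟩
  obtain ⟨ξ, hξ⟩ := exists_isSchneiderValue (p := p) hblock.one_le b₀
  obtain ⟨F, e, s, u, v, h⟩ := hblock.exists_isApproxSequence hb₀.le hξ
  have h2 : 2 ≤ w := by linarith
  -- The difference of the two sides is the quadratic of `hwd` plus `w - 2`, which is positive.
  have h3 : 2 * (d : ℝ) * w < (w - 2) * (w + 1 - d) := by nlinarith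
  have h4 : (d : ℝ) < w + 1 := by linarith
  exact ⟨ξ, hξ, fun n hn hnd =>
    ⟨le_antisymm (h.exponentWStar_le hnd h2 h3 h4) (h.le_exponentWStar hn h2),
      le_antisymm (h.exponentW_le hnd h2 h3 h4) (h.le_exponentW hn h2)⟩⟩
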